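/- A convex geometric $r$-graph is an $r$-uniform hypergraph whose vertex set is cyclically ordered. The crossing $k$-path $CP_k^r$ is the tight path with vertices $v_0,v_1,\dots,v_{r+k-2}$ and edges $\{v_i,v_{i+1},\dots,v_{i+r-1}\}$, $0\le i<k$, whose vertices occur in the cyclic order $$v_0<v_r<v_{2r}<\cdots<v_1<v_{r+1}<v_{2r+1}<\cdots<v_{r-1}<v_{2r-1}<v_{3r-1}<\cdots .$$ Let $\mathrm{ex}_{\circlearrowright}(n,CP_k^r)$ be the maximum number of edges of a convex geometric $r$-graph on $n$ vertices that does not contain $CP_k^r$, where containment means an injective map of the vertices that preserves the cyclic order and sends edges to edges. **Theorem.** Let $k\ge 1$, $r\ge 2$ and $n\ge 2r+1$. Then $$\mathrm{ex}_{\circlearrowright}(n,CP_k^r)=\begin{cases}\Theta(n^{r-1}) & \text{for } 2\le k\le 2r-1,\\[2pt] \binom{n}{r}-\binom{n-r}{r} & \text{for } k=r+1,\\[2pt] \Theta(n^{r-1}\log n) & \text{for } k\ge 2r,\end{cases}$$ and $\mathrm{ex}_{\circlearrowright}(n,CP_1^r)=0$. The constants implied by $\Theta$ are positive, depend only on $r$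 and $k$, and are valid for all $n\ge 2r+1$. -/

import Mathlib

/-- `F` is contained in `H` as a convex geometric hypergraph: there is an injective map of the
vertices of `F` to those of `H` that preserves the cyclic order and sends edges to edges. A
hypergraph on `V` is given by its set of edges. -/
def CGContains {V W : Type*} [CircularOrder V] [CircularOrder W] [DecidableEq V]
    (H : Finset (Finset V)) (F : Finset (Finset W)) : Prop :=
  ∃ φ : W → V, Function.Injective φ ∧
    (∀ a b c : W, sbtw a b c → sbtw (φ a) (φ b) (φ c)) ∧
    ∀ e ∈ F, e.image φ ∈ H

/-- The numbers of edges of the `r`-graphs on the `n` cyclically ordered vertices `Fin n` that do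
not contain `F`. -/
def cgFreeSizes {W : Type*} [CircularOrder W] (r n : ℕ) (F : Finset (Finset W)) : Set ℕ :=
  {m | ∃ H : Finset (Finset (Fin n)), (H : Set (Finset (Fin n))).Sized r ∧
    ¬ CGContains H F ∧ H.card = m}

/-- The maximum number of edges of a convex geometric `r`-graph with `n` vertices that does not
contain `F` (it is attained as soon as `F` has an edge, see `cgEx_isGreatest`). -/
noncomputable def cgEx {W : Type*} [CircularOrder W] (r n : ℕ) (F : Finset (Finset W)) : ℕ :=
  sSup (cgFreeSizes r n F)

theorem cgEx_isGreatest {W : Type*} [CircularOrder W] (r n : ℕ) (F : Finset (Finset W))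
    (hF : F.Nonempty) : IsGreatest (cgFreeSizes r n F) (cgEx r n F) := by
  have hb : BddAbove (cgFreeSizes r n F) := by
    refine ⟨Fintype.card (Finset (Fin n)), ?_⟩
    rintro m ⟨H, -, -, rfl⟩
    exact Finset.card_le_univ H
  have hne : (cgFreeSizes r n F).Nonempty := by
    refine ⟨0, ∅, ?_, ?_, rfl⟩
    · intro e he
      simp at he
    · rintro ⟨φ, -, -, h⟩
      obtain ⟨e, he⟩ := hF
      simpa using h e he
  exact ⟨Nat.sSup_mem hne hb, fun m hm => le_csSup hb hm⟩

/-- The vertices `v_0, v_1, …, v_{r+k-2}` of the crossing path `CP_k^r`. This is not reducible to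
`Fin`, since the order of the vertices is not that of their indices. -/
def CPVertex (r k : ℕ) : Type := Fin (r + k - 1)

namespace CPVertex

/-- The vertex with index `j`. -/
def mk {r k : ℕ} (j : ℕ) (hj : j < r + k - 1) : CPVertex r k := (⟨j, hj⟩ : Fin (r + k - 1))

/-- The index of a vertex. -/
def idx {r k : ℕ} (v : CPVertex r k) : ℕ := Fin.val (n := r + k - 1) v

/-- Vertices are compared first by the residue of the index modulo `r`, then by the index. -/
def key {r k : ℕ} (v : CPVertex r k) : ℕ ×ₗ ℕ := toLex (v.idx % r, v.idx)

theorem key_injective {r k : ℕ} : Function.Injective (key : CPVertex r k → ℕ ×ₗ ℕ) := by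
  intro a b h
  have h2 : (ofLex (key a)).2 = (ofLex (key b)).2 := by rw [h]
  exact Fin.ext h2

/-- The order
`v_0 < v_r < v_{2r} < ⋯ < v_1 < v_{r+1} < v_{2r+1} < ⋯ < v_{r-1} < v_{2r-1} < v_{3r-1} < ⋯`. -/
noncomputable instance (r k : ℕ) : LinearOrder (CPVertex r k) :=
  LinearOrder.lift' key key_injective

/-- The cyclic order obtained by closing up the linear order. -/
noncomputable instance (r k : ℕ) : CircularOrder (CPVertex r k) :=
  LinearOrder.toCircularOrder _

/-- The path order has the three defining properties: `v_i < v_j` for `i < j < r`, all of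
`v_j, v_{j+r}, v_{j+2r}, …` lie in increasing order, and, for `j < r - 1`, before `v_{j+1}`. -/
theorem order_spec {r k : ℕ} :
    (∀ (i j : ℕ) (hi : i < r + k - 1) (hj : j < r + k - 1), i < j → j < r →
      (mk i hi : CPVertex r k) < mk j hj) ∧
    (∀ (j s t : ℕ) (hs : j + s * r < r + k - 1) (ht : j + t * r < r + k - 1), j < r → s < t →
      (mk (j + s * r) hs : CPVertex r k) < mk (j + t * r) ht) ∧
    (∀ (j s : ℕ) (hs : j + s * r < r + k - 1) (hj : j + 1 < r + k - 1), j + 1 < r →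
      (mk (j + s * r) hs : CPVertex r k) < mk (j + 1) hj) := by
  refine ⟨fun i j hi hj hij hjr => ?_, fun j s t hs ht hj hst => ?_, fun j s hs hj hjr => ?_⟩
  · change toLex (i % r, i) < toLex (j % r, j)
    rw [Nat.mod_eq_of_lt (hij.trans hjr), Nat.mod_eq_of_lt hjr]
    exact Prod.Lex.toLex_lt_toLex.2 (Or.inl hij)
  · change toLex ((j + s * r) % r, j + s * r) < toLex ((j + t * r) % r, j + t * r)
    rw [Nat.add_mul_mod_self_right, Nat.add_mul_mod_self_right]
    refine Prod.Lex.toLex_lt_toLex.2 (Or.inr ⟨rfl, ?_⟩)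
    have := Nat.mul_lt_mul_of_pos_right hst (by omega : 0 < r)
    simp only
    omega
  · change toLex ((j + s * r) % r, j + s * r) < toLex ((j + 1) % r, j + 1)
    rw [Nat.add_mul_mod_self_right, Nat.mod_eq_of_lt (by omega), Nat.mod_eq_of_lt hjr]
    exact Prod.Lex.toLex_lt_toLex.2 (Or.inl (Nat.lt_succ_self j))

end CPVertex

open Classical in
/-- The `r`-uniform crossing `k`-path `CP_k^r`: its edges are
`{v_i, v_{i+1}, …, v_{i+r-1}}` for `0 ≤ i < k`. -/
noncomputable def crossingPath (r k : ℕ) : Finset (Finset (CPVertex r k)) :=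
  (Finset.univ : Finset (Fin k)).image fun i =>
    (Finset.univ : Finset (Fin r)).image fun t =>
      CPVertex.mk (i.val + t.val) (by omega)

/-!
A copy of the crossing path is built by moving the vertices of an edge one at a time. Write an edge
as an increasing `r`-tuple of integers; along the path, the entries in the positions
`0, 1, …, r - 1, 0, 1, …` increase in turn. If no entry ever passes the initial value of the next
position (the position after the last one being the first one, shifted by `n`), then the entries,
read modulo `n`, are the vertices of a crossing path in the right cyclic order
(`cgContains_crossingPath_of_chain`). To find such a chain of moves inside a family of tuples, the
tuples that cannot be reached by a move are discarded round by round; if fewer tuples are lost than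
there are, a chain survives (`exists_chain`).

* For `k = r + 1` every position moves once, so any move is allowed. The tuples lost in round `i`
  are determined by the entries outside position `i`. Each earlier move has left a hole behind, and
  closing up the holes shows that at most `(n - i - 1).choose (r - 1)` tuples are lost
  (`card_reach_sdiff_le`); these numbers add up to `n.choose r - (n - r).choose r`. Equality is
  attained by the sets that contain the last vertex or two consecutive ones, because the first and
  the last edge of the path are disjoint and each separates the vertices of the other
  (`lastOrConsecutive_free`).

* For general `k` every move is required to be at most a `1 / (2 k)` part of the adjacent gaps, which
  keeps all entries in place (`sub_lt_gap_of_limitedRaise`). If the entries outside one position are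
  fixed, the lost values of this entry approach the two neighbours geometrically, so that
  `O(log n)` of them are lost. This gives `O(n ^ (r - 1) * log n)`.

* For `k ≤ 2 r - 1` the logarithm disappears. Rotate every edge such that its smallest cyclic gap,
  of length `d`, is the one between the last two positions. The position before this gap moves only
  once, and before the last position does, so that this gap need not limit the moves. Then the two
  positions next to the gap lose `O(1)` values in each fibre, since their distances to the other
  neighbour vary by a factor of at most `2`, and the remaining positions lose `O(1 + log (n / d))`
  values, which is `O(1)` on average over `d` (`card_round_le`, `sum_log_div_le`).

* A residue class modulo `n` of the sum of the vertices contains no path with two edges, which gives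
  the lower bound of order `n ^ (r - 1)` (`choose_div_le_cgEx`). For the logarithm in the case
  `k ≥ 2 r`, take the edges `{x, y} ∪ Z` with `x` even, `y - x = 2 ^ s - 1`, both in the lower half of
  the vertices, and `Z` in the upper half. A path of `2 r` edges would yield `x₁ < x₂ < y₁ < y₂` such
  that `y₁ - x₁`, `y₂ - x₁` and `y₂ - x₂` have this form, which is impossible (`dyadicGraph_free`).
-/

/-! ### Cyclic order on residues and copies of crossing paths -/

/-- The residue of an integer modulo `n`, as one of the cyclically ordered vertices `Fin n`. -/
def residue (n : ℕ) [NeZero n] (x : ℤ) : Fin n :=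
  ⟨(x % n).toNat, by
    have hn : (0 : ℤ) < n := by exact_mod_cast Nat.pos_of_neZero n
    have := Int.emod_lt_of_pos x hn
    have := Int.emod_nonneg x hn.ne'
    omega⟩

theorem residue_val (n : ℕ) [NeZero n] (x : ℤ) : ((residue n x : ℕ) : ℤ) = x % n := by
  have hn : (0 : ℤ) < n := by exact_mod_cast Nat.pos_of_neZero n
  exact Int.toNat_of_nonneg (Int.emod_nonneg x hn.ne')

theorem residue_natCast_add_mul (n : ℕ) [NeZero n] (c : Fin n) (m : ℤ) :
    residue n ((c : ℕ) + n * m) = c := by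
  apply Fin.ext
  have h := residue_val n ((c : ℕ) + n * m)
  rw [Int.add_mul_emod_self_left, Int.emod_eq_of_lt (by omega) (by exact_mod_cast c.2)] at h
  exact_mod_cast h

theorem residue_natCast (n : ℕ) [NeZero n] (c : Fin n) : residue n ((c : ℕ) : ℤ) = c := by
  simpa using residue_natCast_add_mul n c 0

theorem Int.emod_eq_or_sub {n y : ℤ} (h0 : 0 ≤ y) (h2 : y < 2 * n) :
    (y < n ∧ y % n = y) ∨ (n ≤ y ∧ y % n = y - n) := by
  rcases lt_or_ge y n with h | h
  · exact Or.inl ⟨h, Int.emod_eq_of_lt h0 h⟩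
  · refine Or.inr ⟨h, ?_⟩
    rw [← Int.sub_emod_right, Int.emod_eq_of_lt (by omega) (by omega)]

/-- Integers in a window of length `n` have cyclically ordered residues. -/
theorem sbtw_residue (n : ℕ) [NeZero n] {x y z : ℤ} (hxy : x < y) (hyz : y < z) (hzx : z < x + n) :
    sbtw (residue n x) (residue n y) (residue n z) := by
  have hn : (0 : ℤ) < n := by exact_mod_cast Nat.pos_of_neZero n
  have key : ∀ w : ℤ, ((residue n w : ℕ) : ℤ) = (w - n * (x / n)) % n := fun w => by
    rw [residue_val, Int.sub_mul_emod_self_left]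
  have hx := key x
  have hy := key y
  have hz := key z
  have h1 := Int.emod_nonneg x hn.ne'
  have h2 := Int.emod_lt_of_pos x hn
  rw [Int.emod_def] at h1 h2
  have ex := Int.emod_eq_or_sub (n := n) (y := x - n * (x / n)) (by omega) (by omega)
  have ey := Int.emod_eq_or_sub (n := n) (y := y - n * (x / n)) (by omega) (by omega)
  have ez := Int.emod_eq_or_sub (n := n) (y := z - n * (x / n)) (by omega) (by omega)
  change residue n x < residue n y ∧ residue n y < residue n z ∨
    residue n y < residue n z ∧ residue n z < residue n x ∨
    residue n z < residue n x ∧ residue n x < residue n y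
  simp only [Fin.lt_def]
  omega

theorem residue_ne_of_lt (n : ℕ) [NeZero n] {x y : ℤ} (hxy : x < y) (hyx : y < x + n) :
    residue n x ≠ residue n y := by
  intro h
  have h1 := residue_val n x
  rw [h, residue_val] at h1
  have h2 : (n : ℤ) ∣ y - x := Int.ModEq.dvd (a := x) (b := y) h1.symm
  have := Int.le_of_dvd (by omega) h2
  omega

/-- A strictly increasing integer labelling of a linear order, with all labels in a window of
length `n`, gives a copy in the cyclically ordered set `Fin n`. -/
theorem cgContains_of_strictMono {W : Type*} [LinearOrder W] (n : ℕ) [NeZero n]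
    (H : Finset (Finset (Fin n))) (F : Finset (Finset W)) (v : W → ℤ) (hv : StrictMono v)
    (hwin : ∀ a b, v b < v a + n) (hF : ∀ e ∈ F, e.image (fun w => residue n (v w)) ∈ H) :
    @CGContains _ _ _ (LinearOrder.toCircularOrder W) _ H F := by
  let _ := LinearOrder.toCircularOrder W
  refine ⟨fun w => residue n (v w), ?_, ?_, hF⟩
  · intro a b hab
    by_contra hne
    rcases lt_or_gt_of_ne hne with h | h
    · exact residue_ne_of_lt n (hv h) (hwin a b) hab
    · exact residue_ne_of_lt n (hv h) (hwin b a) hab.symm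
  · intro a b c h
    have h' : a < b ∧ b < c ∨ b < c ∧ c < a ∨ c < a ∧ a < b := h
    rcases h' with h | h | h
    · exact sbtw_residue n (hv h.1) (hv h.2) (hwin _ _)
    · exact (sbtw_residue n (hv h.1) (hv h.2) (hwin _ _)).cyclic_right
    · exact (sbtw_residue n (hv h.1) (hv h.2) (hwin _ _)).cyclic_left

/-- The cyclic gap after position `q` of an `(R + 2)`-tuple of integers, thought of as a set of
integers modulo `n`: the gap after the last position leads to the first entry plus `n`. -/
def gap {R : ℕ} (n : ℕ) (a : Fin (R + 2) → ℤ) (q : Fin (R + 2)) : ℤ :=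
  a (q + 1) - a q + if q = Fin.last _ then (n : ℤ) else 0

section gap

variable {R n : ℕ} {a : Fin (R + 2) → ℤ}

theorem gap_castSucc (i : Fin (R + 1)) : gap n a i.castSucc = a i.succ - a i.castSucc := by
  simp [gap, Fin.coeSucc_eq_succ, (Fin.castSucc_lt_last i).ne]

theorem gap_last : gap n a (Fin.last _) = a 0 + n - a (Fin.last _) := by
  simp [gap]; ring

theorem strictMono_of_gap_pos (h : ∀ q, 0 < gap n a q) : StrictMono a := by
  rw [Fin.strictMono_iff_lt_succ]
  intro i
  have := h i.castSucc
  rw [gap_castSucc] at this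
  linarith

theorem lt_add_of_gap_pos (h : ∀ q, 0 < gap n a q) (i j : Fin (R + 2)) : a i < a j + n := by
  have h1 := (strictMono_of_gap_pos h).monotone (Fin.le_last i)
  have h2 := (strictMono_of_gap_pos h).monotone (Fin.zero_le j)
  have h3 := h (Fin.last _)
  rw [gap_last] at h3
  linarith

theorem gap_pos_of_strictMono (h : StrictMono a) (hn : a (Fin.last _) < a 0 + n) (q) :
    0 < gap n a q := by
  induction q using Fin.lastCases with
  | last => rw [gap_last]; linarith
  | cast i =>
    rw [gap_castSucc]
    have := h (Fin.castSucc_lt_succ (i := i))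
    linarith

end gap

section extract

variable {R n : ℕ}

theorem mod_add_two_eq_iff (R i j : ℕ) : (Fin.ofNat (R + 2) i = Fin.ofNat (R + 2) j) ↔
    i % (R + 2) = j % (R + 2) := by
  simp [Fin.ext_iff]

theorem exists_add_mod_eq (t : ℕ) (q : Fin (R + 2)) :
    ∃ s < R + 2, Fin.ofNat (R + 2) (t + s) = q := by
  refine ⟨(q + (R + 2) - t % (R + 2)) % (R + 2), Nat.mod_lt _ (by omega), Fin.ext ?_⟩
  change (t + (q + (R + 2) - t % (R + 2)) % (R + 2)) % (R + 2) = q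
  have h1 := Nat.mod_lt t (show 0 < R + 2 by omega)
  rw [Nat.add_mod_mod, ← Nat.mod_add_mod,
    show t % (R + 2) + (q + (R + 2) - t % (R + 2)) = q + (R + 2) by omega, Nat.add_mod_right,
    Nat.mod_eq_of_lt q.2]

theorem eq_of_not_moved {k : ℕ} {A : ℕ → Fin (R + 2) → ℤ}
    (hstep : ∀ t, t + 1 < k → ∃ x, A (t + 1) = Function.update (A t) (Fin.ofNat _ t) x)
    {q : Fin (R + 2)} {s t : ℕ} (hst : s ≤ t) (ht : t < k)
    (hu : ∀ u, s ≤ u → u < t → q ≠ Fin.ofNat _ u) : A t q = A s q := by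
  induction t, hst using Nat.le_induction with
  | base => rfl
  | succ t hst ih =>
    obtain ⟨x, hx⟩ := hstep t ht
    rw [hx, Function.update_of_ne (hu t hst (by omega))]
    exact ih (by omega) fun u h1 h2 => hu u h1 (by omega)

/-- If the tuples `A 0, A 1, …` arise by increasing the entries in the positions `0, 1, …, r - 1`,
`0, 1, …` in turn, and no entry ever passes the initial value of the next position, then the
entries label the vertices of a crossing path. -/
theorem cgContains_crossingPath_of_chain [NeZero n] (k : ℕ) (hk : 1 ≤ k)
    (H : Finset (Finset (Fin n)))
    (A : ℕ → Fin (R + 2) → ℤ)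
    (hstep : ∀ t, t + 1 < k → ∃ x, A (t + 1) = Function.update (A t) (Fin.ofNat _ t) x ∧
      A t (Fin.ofNat _ t) < x)
    (hH : ∀ t < k, Finset.univ.image (fun j => residue n (A t j)) ∈ H)
    (hgap : ∀ t < k, ∀ q, A t q - A 0 q < gap n (A 0) q) :
    CGContains H (crossingPath (R + 2) k) := by
  have hstep' : ∀ t, t + 1 < k → (∀ q, q ≠ Fin.ofNat _ t → A (t + 1) q = A t q) ∧
      A t (Fin.ofNat _ t) < A (t + 1) (Fin.ofNat _ t) := by
    intro t ht
    obtain ⟨x, hx, hlt⟩ := hstep t ht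
    rw [hx]
    exact ⟨fun q hq => Function.update_of_ne hq _ _, by simpa using hlt⟩
  have hmono : ∀ q s t, s ≤ t → t < k → A s q ≤ A t q := by
    intro q s t hst
    induction t, hst using Nat.le_induction with
    | base => intro _; exact le_rfl
    | succ t hst ih =>
      intro ht
      have h1 := ih (by omega)
      obtain ⟨h2, h3⟩ := hstep' t ht
      by_cases hq : q = Fin.ofNat _ t
      · subst hq; linarith
      · rw [h2 q hq]; exact h1
  have h0 : ∀ q, 0 < gap n (A 0) q := fun q => by simpa using hgap 0 (by omega) q
  have hsm := strictMono_of_gap_pos h0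
  -- the label of the vertex with index `i`: the entry that the moves put there
  set v : ℕ → ℤ := fun i => A (i + 1 - (R + 2)) (Fin.ofNat _ i) with hvdef
  have hlow : ∀ i, i < R + 2 + k - 1 → A 0 (Fin.ofNat _ i) ≤ v i := fun i hi =>
    hmono _ _ _ (Nat.zero_le _) (by omega)
  have hup : ∀ i, i < R + 2 + k - 1 → v i - A 0 (Fin.ofNat _ i) < gap n (A 0) (Fin.ofNat _ i) :=
    fun i hi => hgap _ (by omega) _
  have hwindow : ∀ t < k, ∀ i, t ≤ i → i < t + (R + 2) → A t (Fin.ofNat _ i) = v i := by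
    intro t ht i h1 h2
    refine eq_of_not_moved (fun t ht => (hstep t ht).imp fun _ h => h.1) (by omega) ht ?_
    intro u hu1 hu2 he
    rw [mod_add_two_eq_iff] at he
    have h3 : (i - u) % (R + 2) = 0 := by
      rw [← Nat.dvd_iff_mod_eq_zero]
      exact (Nat.modEq_iff_dvd' (by omega)).1 he.symm
    rw [Nat.mod_eq_of_lt (by omega)] at h3
    omega
  refine cgContains_of_strictMono n H _ (fun w => v w.idx) ?_ ?_ ?_
  · intro a b hab
    have ha : a.idx < R + 2 + k - 1 := a.2
    have hb : b.idx < R + 2 + k - 1 := b.2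
    have hab' : toLex (a.idx % (R + 2), a.idx) < toLex (b.idx % (R + 2), b.idx) := hab
    rw [Prod.Lex.toLex_lt_toLex] at hab'
    change v a.idx < v b.idx
    generalize a.idx = i at *
    generalize b.idx = j at *
    rcases hab' with h | ⟨h, hlt⟩
    · simp only at h
      have hlt : Fin.ofNat (R + 2) i < Fin.ofNat (R + 2) j := h
      have hne : Fin.ofNat (R + 2) i ≠ Fin.last _ := (hlt.trans_le (Fin.le_last _)).ne
      have h1 := hup i ha
      have h2 := hlow j hb
      have h3 : A 0 (Fin.ofNat (R + 2) i + 1) ≤ A 0 (Fin.ofNat (R + 2) j) :=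
        hsm.monotone (Fin.add_one_le_of_lt hlt)
      simp only [gap, hne, if_false] at h1
      linarith
    · simp only at h hlt
      have hd : (R + 2) ∣ j - i := (Nat.modEq_iff_dvd' hlt.le).1 h
      have hle := Nat.le_of_dvd (by omega) hd
      have he : Fin.ofNat (R + 2) i = Fin.ofNat (R + 2) j := (mod_add_two_eq_iff _ _ _).2 h
      have he2 : Fin.ofNat (R + 2) (j - (R + 2)) = Fin.ofNat (R + 2) j := by
        rw [mod_add_two_eq_iff]
        conv_rhs => rw [show j = j - (R + 2) + (R + 2) by omega]
        simp
      have h1 := (hstep' (j - (R + 2)) (by omega)).2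
      rw [he2] at h1
      have h2 := hmono (Fin.ofNat (R + 2) j) (i + 1 - (R + 2)) (j - (R + 2)) (by omega) (by omega)
      simp only [hvdef, he]
      rw [show j + 1 - (R + 2) = j - (R + 2) + 1 by omega]
      linarith
  · intro a b
    have ha : a.idx < R + 2 + k - 1 := a.2
    have hb : b.idx < R + 2 + k - 1 := b.2
    have h1 := hup _ hb
    have h2 := hlow _ ha
    have h3 := hsm.monotone (Fin.zero_le (Fin.ofNat (R + 2) a.idx))
    have h4 : A 0 (Fin.ofNat (R + 2) b.idx) + gap n (A 0) (Fin.ofNat (R + 2) b.idx) ≤ A 0 0 + n := by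
      generalize Fin.ofNat (R + 2) b.idx = q
      induction q using Fin.lastCases with
      | last => rw [gap_last]; linarith
      | cast i =>
        rw [gap_castSucc]
        have := lt_add_of_gap_pos h0 i.succ 0
        linarith
    change v b.idx < v a.idx + n
    linarith
  · intro e he
    simp only [crossingPath, Finset.mem_image, Finset.mem_univ, true_and] at he
    obtain ⟨t, rfl⟩ := he
    convert hH t t.2 using 1
    ext y
    simp only [Finset.mem_image, Finset.mem_univ, true_and, exists_exists_eq_and]
    constructor
    · rintro ⟨s, rfl⟩
      refine ⟨Fin.ofNat _ (t + s), ?_⟩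
      rw [hwindow t t.2 (t + s) (by omega) (by omega)]
      rfl
    · rintro ⟨q, rfl⟩
      obtain ⟨s, hs, hq'⟩ := exists_add_mod_eq t.val q
      refine ⟨⟨s, hs⟩, ?_⟩
      rw [← hq', hwindow t t.2 (t + s) (by omega) (by omega)]
      rfl

end extract

/-! ### Chains of moves -/

section chain

variable {α : Type*}

open Classical in
/-- The elements of `T` that end a chain of `t` moves inside `T`, the `i`-th of them being allowed
by `m i`. -/
noncomputable def reach (T : Finset α) (m : ℕ → α → α → Prop) : ℕ → Finset α
  | 0 => T
  | t + 1 => T.filter fun a' => ∃ a, a ∈ reach T m t ∧ m t a a'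

theorem reach_subset (T : Finset α) (m : ℕ → α → α → Prop) (t : ℕ) : reach T m t ⊆ T := by
  cases t with
  | zero => exact subset_rfl
  | succ t =>
    intro a ha
    simp only [reach, Finset.mem_filter] at ha
    exact ha.1

theorem mem_reach_succ {T : Finset α} {m : ℕ → α → α → Prop} {t : ℕ} {a' : α} :
    a' ∈ reach T m (t + 1) ↔ a' ∈ T ∧ ∃ a ∈ reach T m t, m t a a' := by
  simp [reach]

theorem not_move_of_mem_sdiff [DecidableEq α] {T : Finset α} {m : ℕ → α → α → Prop} {t : ℕ}
    {a a' : α}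
    (ha : a ∈ reach T m t \ reach T m (t + 1)) (ha' : a' ∈ reach T m t \ reach T m (t + 1)) :
    ¬ m t a a' := by
  intro h
  rw [Finset.mem_sdiff] at ha ha'
  exact ha'.2 (mem_reach_succ.2 ⟨reach_subset T m t ha'.1, a, ha.1, h⟩)

theorem exists_chain_of_mem_reach {T : Finset α} {m : ℕ → α → α → Prop} {K : ℕ} {a : α}
    (ha : a ∈ reach T m K) :
    ∃ A : ℕ → α, A K = a ∧ (∀ t ≤ K, A t ∈ T) ∧ ∀ t < K, m t (A t) (A (t + 1)) := by
  induction K generalizing a with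
  | zero => exact ⟨fun _ => a, rfl, fun _ _ => ha, fun t ht => absurd ht (Nat.not_lt_zero t)⟩
  | succ K ih =>
    obtain ⟨haT, b, hb, hm⟩ := mem_reach_succ.1 ha
    obtain ⟨A, hA, hT, hA'⟩ := ih hb
    refine ⟨Function.update A (K + 1) a, by simp, fun t ht => ?_, fun t ht => ?_⟩
    · rcases Nat.lt_or_ge K t with h | h
      · obtain rfl : t = K + 1 := by omega
        simpa using haT
      · rw [Function.update_of_ne (by omega)]
        exact hT t h
    · rw [Function.update_of_ne (by omega)]
      rcases Nat.lt_or_ge t K with h | h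
      · rw [Function.update_of_ne (by omega)]
        exact hA' t h
      · obtain rfl : t = K := by omega
        rw [hA]
        simpa using hm

/-- If every round loses few elements, then some chain survives all the rounds. -/
theorem exists_chain [DecidableEq α] (T : Finset α) (m : ℕ → α → α → Prop) (K : ℕ) (c : ℕ → ℝ)
    (hc : ∀ t < K, ((reach T m t \ reach T m (t + 1)).card : ℝ) ≤ c t)
    (hT : ∑ t ∈ Finset.range K, c t < T.card) :
    ∃ A : ℕ → α, (∀ t ≤ K, A t ∈ T) ∧ ∀ t < K, m t (A t) (A (t + 1)) := by
  have h : ∀ t ≤ K, (T.card : ℝ) - ∑ i ∈ Finset.range t, c i ≤ (reach T m t).card := by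
    intro t
    induction t with
    | zero => intro _; simp [reach]
    | succ t ih =>
      intro ht
      rw [Finset.sum_range_succ]
      have h1 := ih (by omega)
      have h2 := hc t (by omega)
      have h3 : ((reach T m t).card : ℝ) ≤
          (reach T m t \ reach T m (t + 1)).card + (reach T m (t + 1)).card := by
        exact_mod_cast Finset.card_le_card_sdiff_add_card
      linarith
  have hpos : 0 < (reach T m K).card := by
    have := h K le_rfl
    have h' : (0 : ℝ) < (reach T m K).card := by linarith
    exact_mod_cast h'
  obtain ⟨a, ha⟩ := Finset.card_pos.1 hpos
  obtain ⟨A, -, h1, h2⟩ := exists_chain_of_mem_reach ha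
  exact ⟨A, h1, h2⟩

end chain

/-! ### Increasing tuples -/

theorem card_strictMono_le {m N : ℕ} (S : Finset (Fin m → ℤ))
    (hS : ∀ a ∈ S, StrictMono a ∧ ∀ i, 0 ≤ a i ∧ a i < N) : S.card ≤ N.choose m := by
  have h1 : (Finset.powersetCard m (Finset.Ico (0 : ℤ) N)).card = N.choose m := by
    simp
  rw [← h1]
  refine Finset.card_le_card_of_injOn (fun a => Finset.univ.image a) ?_ ?_
  · intro a ha
    obtain ⟨h2, h3⟩ := hS a ha
    rw [Finset.mem_coe, Finset.mem_powersetCard]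
    refine ⟨?_, ?_⟩
    · intro x hx
      simp only [Finset.mem_image, Finset.mem_univ, true_and] at hx
      obtain ⟨i, rfl⟩ := hx
      exact Finset.mem_Ico.2 (h3 i)
    · rw [Finset.card_image_of_injective _ h2.injective]
      simp
  · intro a ha b hb hab
    have h2 : ((Finset.univ.image a : Finset ℤ) : Set ℤ) = (Finset.univ.image b : Finset ℤ) :=
      congrArg _ hab
    simp only [Finset.coe_image, Finset.coe_univ, Set.image_univ] at h2
    exact ((hS a ha).1.range_inj (hS b hb).1).1 h2

/-- The increasing enumeration of a set of vertices, as integers. -/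
theorem exists_sorted_tuple {r n : ℕ} (e : Finset (Fin n)) (he : e.card = r) :
    ∃ a : Fin r → ℤ, StrictMono a ∧ (∀ i, 0 ≤ a i ∧ a i < n) ∧
      (∀ i, ∃ x ∈ e, a i = (x : ℕ)) ∧ (∀ x ∈ e, ∃ i, a i = (x : ℕ)) := by
  refine ⟨fun i => ((e.orderEmbOfFin he i : ℕ) : ℤ), ?_, ?_, ?_, ?_⟩
  · intro i j hij
    simp only
    have : e.orderEmbOfFin he i < e.orderEmbOfFin he j := (e.orderEmbOfFin he).strictMono hij
    exact_mod_cast this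
  · intro i
    have := (e.orderEmbOfFin he i).2
    simp only
    omega
  · exact fun i => ⟨_, e.orderEmbOfFin_mem he i, rfl⟩
  · intro x hx
    have : x ∈ Set.range (e.orderEmbOfFin he) := by rw [Finset.range_orderEmbOfFin]; exact hx
    obtain ⟨i, rfl⟩ := this
    exact ⟨i, rfl⟩

section linear

variable {R n : ℕ} [NeZero n]

open Classical in
/-- The edges of `H`, written as increasing tuples of integers in `[0, n)`. -/
noncomputable def sortedTuples (H : Finset (Finset (Fin n))) : Finset (Fin (R + 2) → ℤ) :=
  {a ∈ Fintype.piFinset fun _ => Finset.Ico (0 : ℤ) n |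
    StrictMono a ∧ Finset.univ.image (fun j => residue n (a j)) ∈ H}

theorem mem_sortedTuples {H : Finset (Finset (Fin n))} {a : Fin (R + 2) → ℤ} :
    a ∈ sortedTuples H ↔ (∀ i, 0 ≤ a i ∧ a i < n) ∧ StrictMono a ∧
      Finset.univ.image (fun j => residue n (a j)) ∈ H := by
  simp [sortedTuples]

theorem card_le_card_sortedTuples {H : Finset (Finset (Fin n))}
    (hH : (H : Set (Finset (Fin n))).Sized (R + 2)) :
    H.card ≤ (sortedTuples (R := R) H).card := by
  classical
  refine Finset.card_le_card_of_surjOn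
    (fun a => Finset.univ.image (fun j => residue n (a j))) ?_
  intro e he
  obtain ⟨a, h1, h2, h3, h4⟩ := exists_sorted_tuple e (hH he)
  have himg : Finset.univ.image (fun j => residue n (a j)) = e := by
    ext x
    simp only [Finset.mem_image, Finset.mem_univ, true_and]
    constructor
    · rintro ⟨j, rfl⟩
      obtain ⟨y, hy, hj⟩ := h3 j
      rwa [hj, residue_natCast]
    · intro hx
      obtain ⟨j, hj⟩ := h4 x hx
      exact ⟨j, by rw [hj, residue_natCast]⟩
  refine ⟨a, ?_, himg⟩
  rw [Finset.mem_coe, mem_sortedTuples, himg]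
  exact ⟨h2, h1, he⟩

theorem gap_pos_of_mem_sortedTuples {H : Finset (Finset (Fin n))} {a : Fin (R + 2) → ℤ}
    (ha : a ∈ sortedTuples H) (q) : 0 < gap n a q := by
  rw [mem_sortedTuples] at ha
  refine gap_pos_of_strictMono ha.2.1 ?_ q
  have h1 := ha.1 0
  have h2 := ha.1 (Fin.last _)
  omega

/-- A move in round `t`: the entry in position `t` modulo `R + 2` increases. -/
def RaisesAt (t : ℕ) (a a' : Fin (R + 2) → ℤ) : Prop :=
  ∃ x, a' = Function.update a (Fin.ofNat _ t) x ∧ a (Fin.ofNat _ t) < x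

theorem ofNat_eq_mk {i : ℕ} (hi : i < R + 2) : Fin.ofNat (R + 2) i = ⟨i, hi⟩ :=
  Fin.ext (Nat.mod_eq_of_lt hi)

/-- After the moves in the positions `0, …, i - 1`, there is a hole before each of the first `i`
entries, namely where this entry came from. -/
theorem holes_of_mem_reach {H : Finset (Finset (Fin n))} {i : ℕ} (hi : i ≤ R + 2)
    {a : Fin (R + 2) → ℤ} (ha : a ∈ reach (sortedTuples H) RaisesAt i) :
    ∀ j : Fin (R + 2), j.val < i → 1 ≤ a j ∧ ∀ l < j, a l + 2 ≤ a j := by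
  induction i generalizing a with
  | zero => intro j hj; exact absurd hj (Nat.not_lt_zero _)
  | succ i ih =>
    intro j hj
    obtain ⟨-, b, hb, x, rfl, hx⟩ := mem_reach_succ.1 ha
    have hbT := mem_sortedTuples.1 (reach_subset _ _ _ hb)
    rw [ofNat_eq_mk hi] at hx ⊢
    by_cases hji : j = ⟨i, hi⟩
    · subst hji
      rw [Function.update_self]
      refine ⟨by have := hbT.1 ⟨i, hi⟩; omega, fun l hl => ?_⟩
      rw [Function.update_of_ne hl.ne]
      have := hbT.2.1 hl
      omega
    · have hji' : j.val < i := by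
        have : j.val ≠ i := fun h => hji (Fin.ext h)
        omega
      obtain ⟨h1, h2⟩ := ih (by omega) hb j hji'
      rw [Function.update_of_ne hji]
      refine ⟨h1, fun l hl => ?_⟩
      rw [Function.update_of_ne]
      · exact h2 l hl
      · rintro rfl
        have : i < j.val := hl
        omega

/-- The tuples lost in round `i` differ from each other outside position `i`. Without this position
they have `i + 1` holes, which are closed up here. -/
theorem card_reach_sdiff_le {H : Finset (Finset (Fin n))} {i : ℕ} (hi : i < R + 2) :
    (reach (sortedTuples (R := R) H) RaisesAt i \
      reach (sortedTuples H) RaisesAt (i + 1)).card ≤ (n - (i + 1)).choose (R + 1) := by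
  set D := reach (sortedTuples (R := R) H) RaisesAt i \ reach (sortedTuples H) RaisesAt (i + 1)
    with hD
  set f : (Fin (R + 2) → ℤ) → Fin (R + 1) → ℤ := fun a j =>
    a ((⟨i, hi⟩ : Fin (R + 2)).succAbove j) - min (j.val + 1) (i + 1) with hf
  have hsmall : ∀ (a) (j : Fin (R + 1)), j.val < i →
      f a j = a ⟨j.val, by omega⟩ - (j.val + 1) := by
    intro a j hj
    have h1 : ((⟨i, hi⟩ : Fin (R + 2)).succAbove j) = ⟨j.val, by omega⟩ := by
      rw [Fin.succAbove_of_castSucc_lt _ _ (by exact hj)]; rfl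
    simp only [hf, h1]
    have : min (j.val + 1) (i + 1) = j.val + 1 := by omega
    rw [this]
    push_cast
    rfl
  have hlarge : ∀ (a) (j : Fin (R + 1)), i ≤ j.val →
      f a j = a ⟨j.val + 1, by omega⟩ - (i + 1) := by
    intro a j hj
    have h1 : ((⟨i, hi⟩ : Fin (R + 2)).succAbove j) = ⟨j.val + 1, by omega⟩ := by
      rw [Fin.succAbove_of_le_castSucc _ _ (by exact hj)]; rfl
    simp only [hf, h1]
    have : min (j.val + 1) (i + 1) = i + 1 := by omega
    rw [this]
    push_cast
    rfl
  have hinj : Set.InjOn f D := by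
    intro a ha b hb hab
    have hoff : ∀ q, q ≠ (⟨i, hi⟩ : Fin (R + 2)) → a q = b q := by
      intro q hq
      obtain ⟨j, rfl⟩ := Fin.exists_succAbove_eq hq
      have := congrFun hab j
      simp only [hf] at this
      linarith
    have hup : ∀ a b : Fin (R + 2) → ℤ, (∀ q, q ≠ (⟨i, hi⟩ : Fin (R + 2)) → a q = b q) →
        a ⟨i, hi⟩ < b ⟨i, hi⟩ → RaisesAt i a b := by
      intro a b hoff hlt
      refine ⟨b ⟨i, hi⟩, ?_, by rwa [ofNat_eq_mk hi]⟩
      rw [ofNat_eq_mk hi]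
      funext q
      by_cases hq : q = ⟨i, hi⟩
      · subst hq; simp
      · rw [Function.update_of_ne hq, hoff q hq]
    rcases lt_trichotomy (a ⟨i, hi⟩) (b ⟨i, hi⟩) with h | h | h
    · exact absurd (hup a b hoff h) (not_move_of_mem_sdiff ha hb)
    · funext q
      by_cases hq : q = ⟨i, hi⟩
      · subst hq; exact h
      · exact hoff q hq
    · exact absurd (hup b a (fun q hq => (hoff q hq).symm) h) (not_move_of_mem_sdiff hb ha)
  rw [← Finset.card_image_of_injOn hinj]
  refine card_strictMono_le _ ?_
  intro b hb
  obtain ⟨a, ha, rfl⟩ := Finset.mem_image.1 hb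
  have hr := (Finset.mem_sdiff.1 ha).1
  have hT := mem_sortedTuples.1 (reach_subset _ _ _ hr)
  have hole := holes_of_mem_reach hi.le hr
  have hmono : StrictMono (f a) := by
    rw [Fin.strictMono_iff_lt_succ]
    intro s
    have hs := s.2
    have e1 : (s.castSucc : Fin (R + 1)).val = s.val := rfl
    have e2 : (s.succ : Fin (R + 1)).val = s.val + 1 := rfl
    rcases lt_trichotomy (s.val + 1) i with h | h | h
    · rw [hsmall a _ (by omega), hsmall a _ (by omega)]
      have := (hole ⟨s.val + 1, by omega⟩ h).2 ⟨s.val, by omega⟩ (Fin.mk_lt_mk.2 (by omega))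
      simp only [e1, e2]
      push_cast
      omega
    · rw [hsmall a _ (by omega), hlarge a _ (by omega)]
      have h1 := hT.2.1 (show (⟨s.val, by omega⟩ : Fin (R + 2)) < ⟨s.val + 1, by omega⟩ from
        Fin.mk_lt_mk.2 (by omega))
      have h2 := hT.2.1 (show (⟨s.val + 1, by omega⟩ : Fin (R + 2)) < ⟨s.val + 1 + 1, by omega⟩
        from Fin.mk_lt_mk.2 (by omega))
      simp only [e1, e2]
      omega
    · rw [hlarge a _ (by omega), hlarge a _ (by omega)]
      have h2 := hT.2.1 (show (⟨s.val + 1, by omega⟩ : Fin (R + 2)) < ⟨s.val + 1 + 1, by omega⟩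
        from Fin.mk_lt_mk.2 (by omega))
      simp only [e1, e2]
      omega
  refine ⟨hmono, fun j => ⟨?_, ?_⟩⟩
  · refine le_trans ?_ (hmono.monotone (Fin.zero_le j))
    rcases Nat.eq_zero_or_pos i with h | h
    · rw [hlarge a 0 (by simp [h])]
      have h1 := hT.2.1 (show (⟨0, by omega⟩ : Fin (R + 2)) < ⟨0 + 1, by omega⟩ from
        Fin.mk_lt_mk.2 (by omega))
      have h2 := (hT.1 ⟨0, by omega⟩).1
      simp only [Fin.val_zero]
      omega
    · rw [hsmall a 0 (by simpa using h)]
      have := (hole ⟨0, by omega⟩ h).1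
      simp only [Fin.val_zero]
      push_cast
      omega
  · refine lt_of_le_of_lt (hmono.monotone (Fin.le_last j)) ?_
    have hl := (hT.1 ⟨R + 1, by omega⟩).2
    rcases Nat.lt_or_ge R i with h | h
    · rw [hsmall a _ (by simpa using h)]
      have h1 := hT.2.1 (show (⟨R, by omega⟩ : Fin (R + 2)) < ⟨R + 1, by omega⟩ from
        Fin.mk_lt_mk.2 (by omega))
      simp only [Fin.val_last]
      omega
    · rw [hlarge a _ (by simpa using h)]
      simp only [Fin.val_last]
      omega

theorem sum_choose_eq (N r : ℕ) (m : ℕ) (hm : m ≤ N) :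
    ∑ i ∈ Finset.range m, (N - (i + 1)).choose r + (N - m).choose (r + 1) = N.choose (r + 1) := by
  induction m with
  | zero => simp
  | succ m ih =>
    rw [← ih (by omega), Finset.sum_range_succ, show N - m = N - (m + 1) + 1 by omega,
      Nat.choose_succ_succ]
    ring

/-- The upper bound for the path with `r + 1` edges. -/
theorem card_add_choose_le_of_not_contains {H : Finset (Finset (Fin n))} (hn : R + 2 ≤ n)
    (hH : (H : Set (Finset (Fin n))).Sized (R + 2))
    (hfree : ¬ CGContains H (crossingPath (R + 2) (R + 2 + 1))) :
    H.card + (n - (R + 2)).choose (R + 2) ≤ n.choose (R + 2) := by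
  by_contra hlt
  apply hfree
  have hsum := sum_choose_eq n (R + 1) (R + 2) hn
  obtain ⟨A, hA, hm⟩ := exists_chain (sortedTuples (R := R) H) RaisesAt (R + 2)
    (fun i => ((n - (i + 1)).choose (R + 1) : ℕ))
    (fun t ht => by exact_mod_cast card_reach_sdiff_le ht) (by
      have := card_le_card_sortedTuples hH
      rw [← Nat.cast_sum, Nat.cast_lt]
      simp only [show R + 1 + 1 = R + 2 from rfl] at hsum
      omega)
  refine cgContains_crossingPath_of_chain (R + 2 + 1) (by omega) H A
    (fun t ht => hm t (by omega)) (fun t ht => (mem_sortedTuples.1 (hA t (by omega))).2.2) ?_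
  intro t ht q
  -- position `q` moves only in round `q`, when the next position still has its initial entry
  have hstep : ∀ t, t + 1 < R + 2 + 1 → ∃ x, A (t + 1) =
      Function.update (A t) (Fin.ofNat _ t) x := fun t ht =>
    (hm t (by omega)).imp fun _ h => h.1
  have hle : ∀ t, t ≤ q.val → t < R + 2 + 1 → ∀ p, q ≤ p → A t p = A 0 p := by
    intro t htq ht p hp
    refine eq_of_not_moved hstep (Nat.zero_le t) ht fun u _ hu h => ?_
    rw [ofNat_eq_mk (by omega)] at h
    have h3 : q.val ≤ p.val := hp
    have h4 : p.val = u := congrArg Fin.val h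
    omega
  have h0 := gap_pos_of_mem_sortedTuples (hA 0 (by omega)) q
  have hge : ∀ t, q.val + 1 ≤ t → t < R + 2 + 1 → A t q = A (q.val + 1) q := by
    intro t hqt ht
    refine eq_of_not_moved hstep hqt ht fun u hu hut h => ?_
    rw [ofNat_eq_mk (by omega)] at h
    have : q.val = u := congrArg Fin.val h
    omega
  rcases Nat.lt_or_ge q.val t with h | h
  · rw [hge t h ht]
    induction q using Fin.lastCases with
    | last =>
      rw [gap_last]
      have h1 := (mem_sortedTuples.1 (hA ((Fin.last (R + 1)).val + 1) (by simp))).1 (Fin.last _)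
      have h2 := (mem_sortedTuples.1 (hA 0 (by omega))).1 0
      omega
    | cast i =>
      rw [gap_castSucc]
      have h1 := (mem_sortedTuples.1 (hA (i.castSucc.val + 1) i.castSucc.2)).2.1
        (Fin.castSucc_lt_succ (i := i))
      obtain ⟨x, hx, -⟩ := hm i.castSucc.val i.castSucc.2
      have h2 : A (i.castSucc.val + 1) i.succ = A 0 i.succ := by
        rw [hx, Function.update_of_ne, hle _ le_rfl (by have := i.castSucc.2; omega) _
          (Fin.castSucc_lt_succ (i := i)).le]
        rw [ofNat_eq_mk i.castSucc.2]
        exact (Fin.castSucc_lt_succ (i := i)).ne'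
      rw [h2] at h1
      linarith
  · rw [hle t h ht q le_rfl]
    linarith

theorem cgContains_crossingPath_one {H : Finset (Finset (Fin n))}
    (hH : (H : Set (Finset (Fin n))).Sized (R + 2)) (hne : H.Nonempty) :
    CGContains H (crossingPath (R + 2) 1) := by
  have hpos : 0 < (sortedTuples (R := R) H).card :=
    (Finset.card_pos.2 hne).trans_le (card_le_card_sortedTuples hH)
  obtain ⟨a, ha⟩ := Finset.card_pos.1 hpos
  refine cgContains_crossingPath_of_chain 1 le_rfl H (fun _ => a) (fun t ht => by omega)
    (fun t ht => (mem_sortedTuples.1 ha).2.2) fun t ht q => ?_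
  simpa using gap_pos_of_mem_sortedTuples ha q

end linear

/-! ### Constructions without crossing paths -/

theorem crossingPath_nonempty {r k : ℕ} (hk : 1 ≤ k) : (crossingPath r k).Nonempty := by
  have : Nonempty (Fin k) := ⟨⟨0, hk⟩⟩
  exact Finset.univ_nonempty.image _

theorem card_le_cgEx {r k n : ℕ} (hk : 1 ≤ k) {H : Finset (Finset (Fin n))}
    (hH : (H : Set (Finset (Fin n))).Sized r) (hfree : ¬ CGContains H (crossingPath r k)) :
    H.card ≤ cgEx r n (crossingPath r k) :=
  (cgEx_isGreatest r n _ (crossingPath_nonempty hk)).2 ⟨H, hH, hfree, rfl⟩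

theorem exists_card_eq_cgEx {r k : ℕ} (n : ℕ) (hk : 1 ≤ k) : ∃ H : Finset (Finset (Fin n)),
    (H : Set (Finset (Fin n))).Sized r ∧ ¬ CGContains H (crossingPath r k) ∧
      H.card = cgEx r n (crossingPath r k) :=
  (cgEx_isGreatest r n _ (crossingPath_nonempty hk)).1

/-- A copy of a crossing path, as a labelling of the indices of its vertices. -/
theorem exists_labels_of_cgContains {r k n : ℕ} [NeZero n] {H : Finset (Finset (Fin n))}
    (h : CGContains H (crossingPath r k)) : ∃ w : ℕ → Fin n,
      (∀ t < k, (Finset.range r).image (fun s => w (t + s)) ∈ H) ∧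
      (∀ i j, i < r + k - 1 → j < r + k - 1 → w i = w j → i = j) ∧
      ∀ i j l, i < r + k - 1 → j < r + k - 1 → l < r + k - 1 →
        toLex (i % r, i) < toLex (j % r, j) → toLex (j % r, j) < toLex (l % r, l) →
        sbtw (w i) (w j) (w l) := by
  classical
  obtain ⟨φ, hinj, hcyc, hedge⟩ := h
  refine ⟨fun i => if h : i < r + k - 1 then φ (CPVertex.mk i h) else 0, ?_, ?_, ?_⟩
  · intro t ht
    convert hedge ((Finset.univ : Finset (Fin r)).image fun s =>
      CPVertex.mk (t + s.val) (by omega)) (Finset.mem_image.2 ⟨⟨t, ht⟩, Finset.mem_univ _, rfl⟩)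
      using 1
    ext y
    simp only [Finset.mem_image, Finset.mem_range, Finset.mem_univ, true_and,
      exists_exists_eq_and]
    constructor
    · rintro ⟨s, hs, rfl⟩
      exact ⟨⟨s, hs⟩, by rw [dif_pos (by omega)]⟩
    · rintro ⟨s, rfl⟩
      exact ⟨s, s.2, by rw [dif_pos (by omega)]⟩
  · intro i j hi hj hij
    simp only [hi, hj, dif_pos] at hij
    exact congrArg CPVertex.idx (hinj hij)
  · intro i j l hi hj hl hij hjl
    simp only [hi, hj, hl, dif_pos]
    exact hcyc _ _ _ (Or.inl ⟨hij, hjl⟩)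

theorem mod_lex_lt {r i j : ℕ} (h : i % r < j % r ∨ i % r = j % r ∧ i < j) :
    toLex (i % r, i) < toLex (j % r, j) :=
  Prod.Lex.toLex_lt_toLex.2 h

theorem sbtw_fin_iff {n : ℕ} {x y z : Fin n} : sbtw x y z ↔
    x < y ∧ y < z ∨ y < z ∧ z < x ∨ z < x ∧ x < y := Iff.rfl

section exact_lower

/-- The sets of `r` vertices that contain the last vertex or two consecutive ones. -/
def lastOrConsecutive (r n : ℕ) : Finset (Finset (Fin n)) :=
  {e ∈ Finset.powersetCard r Finset.univ |
    ∃ x ∈ e, x.val + 1 = n ∨ ∃ y ∈ e, y.val = x.val + 1}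

/-- The first and the last edge of a path with `r + 1` edges separate each other's vertices, so both
would have to contain the last vertex. -/
theorem lastOrConsecutive_free {r n : ℕ} [NeZero n] :
    ¬ CGContains (lastOrConsecutive r n) (crossingPath r (r + 1)) := by
  intro h
  obtain ⟨w, hedge, hinj, hcyc⟩ := exists_labels_of_cgContains h
  have h0 := (Finset.mem_filter.1 (hedge 0 (by omega))).2
  have h1 := (Finset.mem_filter.1 (hedge r (by omega))).2
  simp only [Finset.mem_image, Finset.mem_range, exists_exists_and_eq_and] at h0 h1
  have hm : ∀ i < r, i % r = i := fun i hi => Nat.mod_eq_of_lt hi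
  have hm' : ∀ i < r, (r + i) % r = i := fun i hi => by
    rw [Nat.add_mod_left, Nat.mod_eq_of_lt hi]
  have hno : ∀ x z y : Fin n, sbtw x z y → y.val ≠ x.val + 1 := by
    intro x z y h
    rw [sbtw_fin_iff] at h
    simp only [Fin.lt_def] at h
    omega
  obtain ⟨i, hi, hi'⟩ := h0
  obtain ⟨j, hj, hj'⟩ := h1
  have hi2 : (w (0 + i)).val + 1 = n := by
    refine hi'.resolve_right ?_
    rintro ⟨l, hl, hil⟩
    rw [zero_add, zero_add] at hil
    rcases lt_trichotomy i l with h | h | h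
    · refine hno _ (w (r + i)) _ (hcyc _ _ _ (by omega) (by omega) (by omega) (mod_lex_lt ?_)
        (mod_lex_lt ?_)) hil
      · rw [hm _ hi, hm' _ hi]; omega
      · rw [hm _ hl, hm' _ hi]; omega
    · subst h; omega
    · refine hno _ (w (r + i)) _ (hcyc l i (r + i) (by omega) (by omega) (by omega)
        (mod_lex_lt ?_) (mod_lex_lt ?_)).cyclic_left hil
      · rw [hm _ hi, hm _ hl]; omega
      · rw [hm _ hi, hm' _ hi]; omega
  have hj2 : (w (r + j)).val + 1 = n := by
    refine hj'.resolve_right ?_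
    rintro ⟨l, hl, hjl⟩
    rcases lt_trichotomy j l with h | h | h
    · refine hno _ (w l) _ (hcyc _ _ _ (by omega) (by omega) (by omega) (mod_lex_lt ?_)
        (mod_lex_lt ?_)) hjl
      · rw [hm _ hl, hm' _ hj]; omega
      · rw [hm _ hl, hm' _ hl]; omega
    · subst h; omega
    · refine hno _ (w l) _ (hcyc l (r + l) (r + j) (by omega) (by omega) (by omega)
        (mod_lex_lt ?_) (mod_lex_lt ?_)).cyclic_right hjl
      · rw [hm _ hl, hm' _ hl]; omega
      · rw [hm' _ hl, hm' _ hj]; omega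
  have := hinj (0 + i) (r + j) (by omega) (by omega) (Fin.ext (by omega))
  omega

theorem choose_le_card_lastOrConsecutive {r n : ℕ} :
    n.choose r ≤ (lastOrConsecutive r n).card + (n - r).choose r := by
  set C := Finset.powersetCard r (Finset.univ : Finset (Fin n)) \ lastOrConsecutive r n with hC
  have hcard : n.choose r = (lastOrConsecutive r n).card + C.card := by
    have h := Finset.card_sdiff_add_card_eq_card (show lastOrConsecutive r n ⊆
      Finset.powersetCard r Finset.univ from Finset.filter_subset _ _)
    rw [Finset.card_powersetCard, Finset.card_univ, Fintype.card_fin, ← hC] at h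
    omega
  rw [hcard, Nat.add_le_add_iff_left]
  have hex : ∀ e : C, ∃ a : Fin r → ℤ, StrictMono a ∧ (∀ i, 0 ≤ a i ∧ a i < n) ∧
      (∀ i, ∃ x ∈ e.1, a i = (x : ℕ)) ∧ (∀ x ∈ e.1, ∃ i, a i = (x : ℕ)) := fun e =>
    exists_sorted_tuple e.1 (Finset.mem_powersetCard.1 (Finset.mem_sdiff.1 e.2).1).2
  choose f hf using hex
  have hinj : Function.Injective fun (e : C) (i : Fin r) => f e i - i := by
    intro e e' h
    have h' : f e = f e' := by
      funext i
      have := congrFun h i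
      simp only at this
      linarith
    apply Subtype.ext
    ext x
    constructor
    · intro hx
      obtain ⟨i, hi⟩ := (hf e).2.2.2 x hx
      obtain ⟨y, hy, hy'⟩ := (hf e').2.2.1 i
      have : x = y := Fin.ext (by rw [h'] at hi; omega)
      rwa [this]
    · intro hx
      obtain ⟨i, hi⟩ := (hf e').2.2.2 x hx
      obtain ⟨y, hy, hy'⟩ := (hf e).2.2.1 i
      have : x = y := Fin.ext (by rw [h'] at hy'; omega)
      rwa [this]
  rw [← Fintype.card_coe C, ← Finset.card_univ, ← Finset.card_image_of_injective _ hinj]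
  refine card_strictMono_le _ ?_
  intro b hb
  obtain ⟨e, -, rfl⟩ := Finset.mem_image.1 hb
  obtain ⟨h1, h2, h3, -⟩ := hf e
  have hno : ∀ x ∈ e.1, x.val + 1 ≠ n ∧ ∀ y ∈ e.1, y.val ≠ x.val + 1 := by
    intro x hx
    have h4 := (Finset.mem_sdiff.1 e.2)
    simp only [lastOrConsecutive, Finset.mem_filter, not_and, not_exists, not_or] at h4
    exact h4.2 h4.1 x hx
  cases r with
  | zero => exact ⟨fun i => i.elim0, fun i => i.elim0⟩
  | succ r =>
    have hmono : StrictMono fun i : Fin (r + 1) => f e i - i := by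
      rw [Fin.strictMono_iff_lt_succ]
      intro i
      have h4 := h1 (Fin.castSucc_lt_succ (i := i))
      obtain ⟨x, hx, hx'⟩ := h3 i.castSucc
      obtain ⟨y, hy, hy'⟩ := h3 i.succ
      have h5 := (hno x hx).2 y hy
      simp only [Fin.val_castSucc, Fin.val_succ]
      push_cast
      omega
    refine ⟨hmono, fun i => ⟨?_, ?_⟩⟩
    · refine le_trans ?_ (hmono.monotone (Fin.zero_le i))
      have := (h2 0).1
      simpa using this
    · refine lt_of_le_of_lt (hmono.monotone (Fin.le_last i)) ?_
      obtain ⟨x, hx, hx'⟩ := h3 (Fin.last r)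
      have h4 := (hno x hx).1
      have h5 := x.2
      simp only [Fin.val_last]
      omega

end exact_lower

section sum_class

/-- Two edges that differ in one vertex have different sums modulo `n`, so by the pigeonhole
principle a residue class of the sum is a large hypergraph without a path of two edges. -/
theorem choose_div_le_cgEx {r k n : ℕ} [NeZero n] (hr : 1 ≤ r) (hk : 2 ≤ k) :
    (n.choose r : ℝ) / n ≤ cgEx r n (crossingPath r k) := by
  have hn : (0 : ℝ) < n := by exact_mod_cast Nat.pos_of_neZero n
  obtain ⟨s, -, hs⟩ := Finset.exists_le_card_fiber_of_nsmul_le_card_of_maps_to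
    (s := Finset.powersetCard r (Finset.univ : Finset (Fin n))) (t := Finset.univ)
    (f := fun e => residue n (∑ x ∈ e, ((x : ℕ) : ℤ))) (b := (n.choose r : ℝ) / n)
    (fun _ _ => Finset.mem_univ _) ⟨0, Finset.mem_univ _⟩ (by
      simp only [Finset.card_univ, Fintype.card_fin, Finset.card_powersetCard, nsmul_eq_mul]
      rw [mul_div_cancel₀ _ hn.ne'])
  refine hs.trans ?_
  rw [Nat.cast_le]
  refine card_le_cgEx (by omega) ?_ ?_
  · intro e he
    exact (Finset.mem_powersetCard.1 (Finset.mem_filter.1 he).1).2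
  · intro h
    obtain ⟨w, hedge, hinj, -⟩ := exists_labels_of_cgContains h
    have hsum : ∀ t < 2, residue n (∑ i ∈ Finset.range r, ((w (t + i) : ℕ) : ℤ)) = s := by
      intro t ht
      have h1 := (Finset.mem_filter.1 (hedge t (by omega))).2
      rwa [Finset.sum_image] at h1
      intro i hi j hj hij
      rw [Finset.mem_coe, Finset.mem_range] at hi hj
      have := hinj _ _ (by omega) (by omega) hij
      omega
    have h0 := hsum 0 (by omega)
    have h1 := hsum 1 (by omega)
    obtain ⟨r, rfl⟩ : ∃ r', r = r' + 1 := ⟨r - 1, by omega⟩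
    rw [Finset.sum_range_succ'] at h0
    rw [Finset.sum_range_succ] at h1
    have e0 := residue_val n (∑ i ∈ Finset.range r, ((w (0 + (i + 1)) : ℕ) : ℤ) + (w (0 + 0) : ℕ))
    have e1 := residue_val n (∑ i ∈ Finset.range r, ((w (1 + i) : ℕ) : ℤ) + (w (1 + r) : ℕ))
    rw [h0] at e0
    rw [h1] at e1
    have e2 : ∑ i ∈ Finset.range r, ((w (0 + (i + 1)) : ℕ) : ℤ) =
        ∑ i ∈ Finset.range r, ((w (1 + i) : ℕ) : ℤ) :=
      Finset.sum_congr rfl fun i _ => by rw [show 0 + (i + 1) = 1 + i by omega]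
    rw [e2] at e0
    have e3 : ((w (0 + 0) : ℕ) : ℤ) ≡ (w (1 + r) : ℕ) [ZMOD n] :=
      Int.ModEq.add_left_cancel' _ (e0.symm.trans e1)
    have e4 := Int.natCast_modEq_iff.1 e3
    rw [Nat.ModEq, Nat.mod_eq_of_lt (w _).2, Nat.mod_eq_of_lt (w _).2] at e4
    have := hinj _ _ (by omega) (by omega) (Fin.ext e4)
    omega

theorem pow_le_choose_of_le {r n : ℕ} (m : ℕ) (h : n + 1 ≤ 2 * (m + 1 - r)) :
    ((n : ℝ) / 2) ^ r / r.factorial ≤ m.choose r := by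
  refine le_trans ?_ (Nat.pow_le_choose (α := ℝ) r m)
  have : (n : ℝ) + 1 ≤ 2 * (m + 1 - r : ℕ) := by exact_mod_cast h
  gcongr
  linarith

theorem pow_le_cgEx {R k n : ℕ} (hk : 2 ≤ k) (hn : 2 * (R + 2) + 1 ≤ n) :
    1 / (2 ^ (R + 2) * (R + 2).factorial : ℝ) * (n : ℝ) ^ (R + 1) ≤
      cgEx (R + 2) n (crossingPath (R + 2) k) := by
  have : NeZero n := ⟨by omega⟩
  have hn0 : (0 : ℝ) < n := by exact_mod_cast Nat.pos_of_neZero n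
  refine le_trans ?_ (choose_div_le_cgEx (by omega) hk)
  rw [le_div_iff₀ hn0]
  refine le_trans (le_of_eq ?_) (pow_le_choose_of_le (r := R + 2) (n := n) n (by omega))
  rw [div_pow]
  field_simp
  ring

end sum_class

section dyadic

/-- The sets `{x, y} ∪ Z` where `x < y` lie in the lower half of the vertices, `x` is even,
`y - x = 2 ^ (s + 1) - 1` for some `s`, and `Z` lies in the upper half. -/
noncomputable def dyadicGraph (r n : ℕ) : Finset (Finset (Fin n)) := by
  classical
  exact {e ∈ Finset.powersetCard r Finset.univ | ∃ x ∈ e, ∃ y ∈ e, Even x.val ∧ y.val < n / 2 ∧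
    (∃ s : ℕ, y.val + 1 = x.val + 2 ^ (s + 1)) ∧ ∀ z ∈ e, z = x ∨ z = y ∨ n / 2 ≤ z.val}

theorem mem_dyadicGraph {r n : ℕ} {e : Finset (Fin n)} : e ∈ dyadicGraph r n ↔ e.card = r ∧
    ∃ x ∈ e, ∃ y ∈ e, Even x.val ∧ y.val < n / 2 ∧
      (∃ s : ℕ, y.val + 1 = x.val + 2 ^ (s + 1)) ∧ ∀ z ∈ e, z = x ∨ z = y ∨ n / 2 ≤ z.val := by
  simp [dyadicGraph]

/-- In an edge, the even and the odd vertex of the lower half are unique, and they differ by one less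
than a power of two. -/
theorem exists_of_mem_dyadicGraph {r n : ℕ} {e : Finset (Fin n)} (he : e ∈ dyadicGraph r n) :
    ∃ x ∈ e, ∃ y ∈ e, (∀ z ∈ e, (z.val < n / 2 ∧ Even z.val) ↔ z = x) ∧
      (∀ z ∈ e, (z.val < n / 2 ∧ ¬ Even z.val) ↔ z = y) ∧
      ∃ s : ℕ, y.val + 1 = x.val + 2 ^ (s + 1) := by
  obtain ⟨-, x, hx, y, hy, hev, hlt, ⟨s, hs⟩, hz⟩ := mem_dyadicGraph.1 he
  have hpow : 2 ^ (s + 1) = 2 * 2 ^ s := pow_succ' 2 s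
  have hpos : 0 < 2 ^ s := by positivity
  have hodd : ¬ Even y.val := by
    rw [Nat.even_iff] at hev ⊢
    omega
  refine ⟨x, hx, y, hy, fun z hze => ?_, fun z hze => ?_, s, hs⟩
  · constructor
    · rintro ⟨h1, h2⟩
      rcases hz z hze with h | h | h
      · exact h
      · subst h; exact absurd h2 hodd
      · omega
    · rintro rfl
      exact ⟨by omega, hev⟩
  · constructor
    · rintro ⟨h1, h2⟩
      rcases hz z hze with h | h | h
      · subst h; exact absurd hev h2
      · exact h
      · omega
    · rintro rfl
      exact ⟨hlt, hodd⟩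

/-- A vertex of the path and the one `r` places later play the same role in their edges. Hence the
lower half contains vertices `x₁ < x₂ < y₁ < y₂` such that `y₁ - x₁`, `y₂ - x₁` and `y₂ - x₂` are all
of the form `2 ^ s - 1`, which is impossible as `y₂ - x₁` is at least twice the other two. -/
theorem dyadicGraph_free {r k n : ℕ} [NeZero n] (hr : 1 ≤ r) (hk : 2 * r ≤ k) :
    ¬ CGContains (dyadicGraph r n) (crossingPath r k) := by
  intro h
  obtain ⟨w, hedge, hinj, hcyc⟩ := exists_labels_of_cgContains h
  have hm : ∀ i < r, i % r = i := fun i hi => Nat.mod_eq_of_lt hi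
  have hm' : ∀ i < r, (i + r) % r = i := fun i hi => by
    rw [Nat.add_mod_right, Nat.mod_eq_of_lt hi]
  have hm'' : ∀ i < r, (i + r + r) % r = i := fun i hi => by
    rw [Nat.add_mod_right, hm' i hi]
  have hmem : ∀ t i, t ≤ i → i < t + r → w i ∈ (Finset.range r).image (fun s => w (t + s)) :=
    fun t i h1 h2 => Finset.mem_image.2 ⟨i - t, Finset.mem_range.2 (by omega), by
      rw [Nat.add_sub_cancel' h1]⟩
  have hidx : ∀ t, ∀ x ∈ (Finset.range r).image (fun s => w (t + s)),
      ∃ i, t ≤ i ∧ i < t + r ∧ w i = x := by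
    intro t x hx
    obtain ⟨s, hs, rfl⟩ := Finset.mem_image.1 hx
    exact ⟨t + s, by omega, by have := Finset.mem_range.1 hs; omega, rfl⟩
  -- the even and the odd vertices of the path in the lower half: one of each in every edge
  set P : ℕ → Prop := fun i => (w i).val < n / 2 ∧ Even (w i).val with hP
  set Q : ℕ → Prop := fun i => (w i).val < n / 2 ∧ ¬ Even (w i).val with hQ
  have hPex : ∀ t < k, ∃ i, t ≤ i ∧ i < t + r ∧ P i := by
    intro t ht
    obtain ⟨x, hx, -, -, h1, -, -⟩ := exists_of_mem_dyadicGraph (hedge t ht)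
    obtain ⟨i, h2, h3, rfl⟩ := hidx t x hx
    exact ⟨i, h2, h3, (h1 _ hx).2 rfl⟩
  have hQex : ∀ t < k, ∃ i, t ≤ i ∧ i < t + r ∧ Q i := by
    intro t ht
    obtain ⟨-, -, y, hy, -, h1, -⟩ := exists_of_mem_dyadicGraph (hedge t ht)
    obtain ⟨i, h2, h3, rfl⟩ := hidx t y hy
    exact ⟨i, h2, h3, (h1 _ hy).2 rfl⟩
  have hPuniq : ∀ t < k, ∀ i j, t ≤ i → i < t + r → t ≤ j → j < t + r → P i → P j → i = j := by
    intro t ht i j h1 h2 h3 h4 hi hj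
    obtain ⟨x, hx, -, -, h5, -, -⟩ := exists_of_mem_dyadicGraph (hedge t ht)
    exact hinj _ _ (by omega) (by omega)
      (((h5 _ (hmem t i h1 h2)).1 hi).trans ((h5 _ (hmem t j h3 h4)).1 hj).symm)
  have hQuniq : ∀ t < k, ∀ i j, t ≤ i → i < t + r → t ≤ j → j < t + r → Q i → Q j → i = j := by
    intro t ht i j h1 h2 h3 h4 hi hj
    obtain ⟨-, -, y, hy, -, h5, -⟩ := exists_of_mem_dyadicGraph (hedge t ht)
    exact hinj _ _ (by omega) (by omega)
      (((h5 _ (hmem t i h1 h2)).1 hi).trans ((h5 _ (hmem t j h3 h4)).1 hj).symm)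
  have hpair : ∀ t < k, ∀ i j, t ≤ i → i < t + r → t ≤ j → j < t + r → P i → Q j →
      ∃ s : ℕ, (w j).val + 1 = (w i).val + 2 ^ (s + 1) := by
    intro t ht i j h1 h2 h3 h4 hi hj
    obtain ⟨x, hx, y, hy, h5, h6, h7⟩ := exists_of_mem_dyadicGraph (hedge t ht)
    rw [(h5 _ (hmem t i h1 h2)).1 hi, (h6 _ (hmem t j h3 h4)).1 hj]
    exact h7
  have hPper : ∀ i, i + 1 < k → P i → P (i + r) := by
    intro i hi hPi
    obtain ⟨j, h1, h2, h3⟩ := hPex (i + 1) hi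
    rcases Nat.lt_or_ge j (i + r) with h | h
    · have := hPuniq i (by omega) i j le_rfl (by omega) (by omega) (by omega) hPi h3
      omega
    · rwa [show i + r = j by omega]
  have hQper : ∀ i, i + 1 < k → Q i → Q (i + r) := by
    intro i hi hQi
    obtain ⟨j, h1, h2, h3⟩ := hQex (i + 1) hi
    rcases Nat.lt_or_ge j (i + r) with h | h
    · have := hQuniq i (by omega) i j le_rfl (by omega) (by omega) (by omega) hQi h3
      omega
    · rwa [show i + r = j by omega]
  have hcontra : ∀ x₁ x₂ y₁ y₂ : Fin n, sbtw x₁ x₂ y₁ → sbtw x₁ y₁ y₂ →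
      (∃ s : ℕ, y₁.val + 1 = x₁.val + 2 ^ (s + 1)) →
      (∃ s : ℕ, y₂.val + 1 = x₁.val + 2 ^ (s + 1)) →
      (∃ s : ℕ, y₂.val + 1 = x₂.val + 2 ^ (s + 1)) → False := by
    rintro x₁ x₂ y₁ y₂ h1 h2 ⟨a, ha⟩ ⟨b, hb⟩ ⟨c, hc⟩
    rw [sbtw_fin_iff] at h1 h2
    simp only [Fin.lt_def] at h1 h2
    have pa := pow_succ' 2 a
    have pb := pow_succ' 2 b
    have pc := pow_succ' 2 c
    have qa : 0 < 2 ^ a := by positivity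
    have qb : 0 < 2 ^ b := by positivity
    have qc : 0 < 2 ^ c := by positivity
    have hab : 2 ^ (a + 1) ≤ 2 ^ b := by
      refine Nat.pow_le_pow_right (by omega) ?_
      by_contra hlt
      have := Nat.pow_le_pow_right (show 0 < 2 by omega) (show b ≤ a by omega)
      omega
    have hcb : 2 ^ (c + 1) ≤ 2 ^ b := by
      refine Nat.pow_le_pow_right (by omega) ?_
      by_contra hlt
      have := Nat.pow_le_pow_right (show 0 < 2 by omega) (show b ≤ c by omega)
      omega
    omega
  -- The even lower vertices are those with index `α` modulo `r`, the odd ones those with index `β`.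
  -- Of the classes, `α` provides `x₁, x₂` and `β` provides `y₁, y₂`. If `α < β`, the first vertex of
  -- `α` is skipped, as `x₂` has to share an edge with `y₂`.
  obtain ⟨α, -, hα, hPα⟩ := hPex 0 (by omega)
  obtain ⟨β, -, hβ, hQβ⟩ := hQex 0 (by omega)
  rw [zero_add] at hα hβ
  have hPα' := hPper α (by omega) hPα
  have hQβ' := hQper β (by omega) hQβ
  rcases lt_trichotomy α β with hlt | heq | hlt
  · have hPα'' := hPper (α + r) (by omega) hPα'
    refine hcontra (w (α + r)) (w (α + r + r)) (w β) (w (β + r)) ?_ ?_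
      (hpair β (by omega) _ _ (by omega) (by omega) (by omega) (by omega) hPα' hQβ)
      (hpair (α + r) (by omega) _ _ (by omega) (by omega) (by omega) (by omega) hPα' hQβ')
      (hpair (β + r) (by omega) _ _ (by omega) (by omega) (by omega) (by omega) hPα'' hQβ')
    · refine hcyc _ _ _ (by omega) (by omega) (by omega) (mod_lex_lt ?_) (mod_lex_lt ?_)
      · rw [hm' α hα, hm'' α hα]; omega
      · rw [hm'' α hα, hm β hβ]; omega
    · refine hcyc _ _ _ (by omega) (by omega) (by omega) (mod_lex_lt ?_) (mod_lex_lt ?_)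
      · rw [hm' α hα, hm β hβ]; omega
      · rw [hm' β hβ, hm β hβ]; omega
  · subst heq
    exact hQβ.2 hPα.2
  · refine hcontra (w α) (w (α + r)) (w β) (w (β + r)) ?_ ?_
      (hpair 0 (by omega) _ _ (by omega) (by omega) (by omega) (by omega) hPα hQβ)
      (hpair α (by omega) _ _ (by omega) (by omega) (by omega) (by omega) hPα hQβ')
      (hpair r (by omega) _ _ (by omega) (by omega) (by omega) (by omega) hPα' hQβ')
    · refine (hcyc β α (α + r) (by omega) (by omega) (by omega) (mod_lex_lt ?_)
        (mod_lex_lt ?_)).cyclic_left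
      · rw [hm α hα, hm β hβ]; omega
      · rw [hm' α hα, hm α hα]; omega
    · refine (hcyc β (β + r) α (by omega) (by omega) (by omega) (mod_lex_lt ?_)
        (mod_lex_lt ?_)).cyclic_right
      · rw [hm' β hβ, hm β hβ]; omega
      · rw [hm' β hβ, hm α hα]; omega

theorem le_card_dyadicGraph {R n : ℕ} (hn : 4 ≤ n) :
    (n / 8) * (Nat.log 2 (n / 4) * (n - n / 2).choose R) ≤ (dyadicGraph (R + 2) n).card := by
  classical
  have : NeZero n := ⟨by omega⟩
  set S := Nat.log 2 (n / 4) with hS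
  set U : Finset (Fin n) := {z | n / 2 ≤ z.val} with hU
  have hpowS : 2 ^ S ≤ n / 4 := Nat.pow_log_le_self 2 (by omega)
  have hUcard : U.card = n - n / 2 := by
    have h1 : U = Finset.Ici (⟨n / 2, by omega⟩ : Fin n) := by
      ext z
      simp [hU, Fin.le_def]
    rw [h1, Fin.card_Ici]
  set x : ℕ → Fin n := fun i => Fin.ofNat n (2 * i) with hx
  set y : ℕ → ℕ → Fin n := fun i s => Fin.ofNat n (2 * i + (2 ^ (s + 1) - 1)) with hy
  have hpow : ∀ s < S, 2 ^ (s + 1) = 2 * 2 ^ s ∧ 0 < 2 ^ s ∧ 2 ^ (s + 1) ≤ n / 4 := fun s hs =>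
    ⟨pow_succ' 2 s, by positivity, (Nat.pow_le_pow_right (by omega) hs).trans hpowS⟩
  have hxv : ∀ i < n / 8, (x i).val = 2 * i := fun i hi => Nat.mod_eq_of_lt (by omega)
  have hyv : ∀ i < n / 8, ∀ s < S, (y i s).val = 2 * i + (2 ^ (s + 1) - 1) := fun i hi s hs =>
    Nat.mod_eq_of_lt (by have := hpow s hs; omega)
  have hcard : (Finset.range (n / 8) ×ˢ (Finset.range S ×ˢ Finset.powersetCard R U)).card =
      (n / 8) * (S * (n - n / 2).choose R) := by
    simp [Finset.card_product, Finset.card_powersetCard, hUcard]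
  rw [← hcard]
  refine Finset.card_le_card_of_injOn
    (fun p => insert (x p.1) (insert (y p.1 p.2.1) p.2.2)) ?_ ?_
  · rintro ⟨i, s, Z⟩ hp
    simp only [Finset.mem_coe, Finset.mem_product, Finset.mem_range,
      Finset.mem_powersetCard] at hp
    obtain ⟨hi, hs, hZ, hZc⟩ := hp
    have h1 := hxv i hi
    have h2 := hyv i hi s hs
    have h3 := hpow s hs
    have hZU : ∀ z ∈ Z, n / 2 ≤ z.val := fun z hz => by simpa [hU] using hZ hz
    have hyZ : y i s ∉ Z := fun h => by have := hZU _ h; omega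
    have hxZ : x i ∉ insert (y i s) Z := by
      rw [Finset.mem_insert]
      rintro (h | h)
      · have := congrArg Fin.val h; omega
      · have := hZU _ h; omega
    rw [Finset.mem_coe, mem_dyadicGraph]
    refine ⟨?_, x i, by simp, y i s, by simp, ⟨i, by omega⟩, by omega, ⟨s, by omega⟩, ?_⟩
    · rw [Finset.card_insert_of_notMem hxZ, Finset.card_insert_of_notMem hyZ, hZc]
    · intro z hz
      simp only [Finset.mem_insert] at hz
      rcases hz with h | h | h
      · exact Or.inl h
      · exact Or.inr (Or.inl h)
      · exact Or.inr (Or.inr (hZU z h))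
  · rintro ⟨i, s, Z⟩ hp ⟨i', s', Z'⟩ hp' heq
    simp only [Finset.mem_coe, Finset.mem_product, Finset.mem_range,
      Finset.mem_powersetCard] at hp hp'
    obtain ⟨hi, hs, hZ, hZc⟩ := hp
    obtain ⟨hi', hs', hZ', hZc'⟩ := hp'
    have h1 := hxv i hi
    have h2 := hyv i hi s hs
    have h3 := hpow s hs
    have h1' := hxv i' hi'
    have h2' := hyv i' hi' s' hs'
    have h3' := hpow s' hs'
    have hZU : ∀ z ∈ Z, n / 2 ≤ z.val := fun z hz => by simpa [hU] using hZ hz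
    have hZU' : ∀ z ∈ Z', n / 2 ≤ z.val := fun z hz => by simpa [hU] using hZ' hz
    simp only at heq
    have hmem : ∀ z, (z = x i ∨ z = y i s ∨ z ∈ Z) ↔ (z = x i' ∨ z = y i' s' ∨ z ∈ Z') := by
      intro z
      have : z ∈ insert (x i) (insert (y i s) Z) ↔ z ∈ insert (x i') (insert (y i' s') Z') := by
        rw [heq]
      simpa only [Finset.mem_insert] using this
    have hii : i = i' := by
      rcases (hmem (x i)).1 (Or.inl rfl) with h | h | h
      · have := congrArg Fin.val h; omega
      · have := congrArg Fin.val h; omega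
      · have := hZU' _ h; omega
    subst hii
    have hss : s = s' := by
      rcases (hmem (y i s)).1 (Or.inr (Or.inl rfl)) with h | h | h
      · have := congrArg Fin.val h; omega
      · have h4 := congrArg Fin.val h
        have h5 : 2 ^ (s + 1) = 2 ^ (s' + 1) := by omega
        have := Nat.pow_right_injective le_rfl h5
        omega
      · have := hZU' _ h; omega
    subst hss
    have hZZ : Z = Z' := by
      ext z
      constructor
      · intro hz
        have h4 := hZU z hz
        rcases (hmem z).1 (Or.inr (Or.inr hz)) with h | h | h
        · have := congrArg Fin.val h; omega
        · have := congrArg Fin.val h; omega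
        · exact h
      · intro hz
        have h4 := hZU' z hz
        rcases (hmem z).2 (Or.inr (Or.inr hz)) with h | h | h
        · have := congrArg Fin.val h; omega
        · have := congrArg Fin.val h; omega
        · exact h
    rw [hZZ]

theorem exists_mul_log_le_cgEx {R k : ℕ} (hk : 2 * (R + 2) ≤ k) :
    ∃ c : ℝ, 0 < c ∧ ∀ n : ℕ, 2 * (R + 2) + 1 ≤ n →
      c * ((n : ℝ) ^ (R + 1) * Real.log n) ≤ cgEx (R + 2) n (crossingPath (R + 2) k) := by
  set c₁ : ℝ := 1 / (2 ^ (R + 2) * (R + 2).factorial : ℝ) with hc₁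
  set c₂ : ℝ := 1 / (32 * (4 ^ R * R.factorial) : ℝ) with hc₂
  -- for `n ≥ N`, rounding costs only a factor of `2` in the logarithm and in `n / 2 - R`
  set N : ℕ := 512 + 4 * (R + 2) with hN
  have hc₁0 : 0 < c₁ := by positivity
  have hc₂0 : 0 < c₂ := by positivity
  have hlogN : 0 < Real.log N := Real.log_pos (by rw [hN]; norm_cast; omega)
  refine ⟨min (c₁ / Real.log N) c₂, lt_min (by positivity) hc₂0, fun n hn => ?_⟩
  have hn0 : (0 : ℝ) < n := by exact_mod_cast (by omega : 0 < n)
  have hlog : 0 ≤ Real.log n := Real.log_natCast_nonneg n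
  rcases Nat.lt_or_ge n N with h | h
  · -- for small `n` the logarithm is bounded
    have h1 : Real.log n ≤ Real.log N := Real.log_le_log hn0 (by exact_mod_cast h.le)
    calc min (c₁ / Real.log N) c₂ * ((n : ℝ) ^ (R + 1) * Real.log n)
        ≤ c₁ / Real.log N * ((n : ℝ) ^ (R + 1) * Real.log N) := by
          gcongr
          exact min_le_left _ _
      _ = c₁ * (n : ℝ) ^ (R + 1) := by field_simp
      _ ≤ _ := pow_le_cgEx (by omega) hn
  · have : NeZero n := ⟨by omega⟩
    have h1 : (dyadicGraph (R + 2) n).card ≤ cgEx (R + 2) n (crossingPath (R + 2) k) :=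
      card_le_cgEx (by omega) (fun e he => (mem_dyadicGraph.1 he).1)
        (dyadicGraph_free (by omega) hk)
    have h2 := (le_card_dyadicGraph (R := R) (n := n) (by omega)).trans h1
    have h3 : ((n / 8 : ℕ) : ℝ) * ((Nat.log 2 (n / 4) : ℕ) * ((n - n / 2).choose R : ℕ)) ≤
        cgEx (R + 2) n (crossingPath (R + 2) k) := by exact_mod_cast h2
    refine le_trans ?_ h3
    have h4 : (n : ℝ) / 16 ≤ (n / 8 : ℕ) := by
      have : (n : ℝ) ≤ 16 * (n / 8 : ℕ) := by exact_mod_cast (by omega : n ≤ 16 * (n / 8))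
      linarith
    have h5 : Real.log n / 2 ≤ (Nat.log 2 (n / 4) : ℕ) := by
      have h6 : n / 4 < 2 ^ (Nat.log 2 (n / 4) + 1) := Nat.lt_pow_succ_log_self (by omega) _
      have h7 : n ≤ 2 ^ (Nat.log 2 (n / 4) + 3) := by
        rw [show Nat.log 2 (n / 4) + 3 = Nat.log 2 (n / 4) + 1 + 2 by omega, pow_add _ _ 2]
        omega
      have h8 : Real.log n ≤ (Nat.log 2 (n / 4) + 3 : ℕ) * Real.log 2 := by
        rw [← Real.log_pow]
        exact Real.log_le_log hn0 (by exact_mod_cast h7)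
      have h9 : 9 * Real.log 2 ≤ Real.log n := by
        have : (9 : ℝ) * Real.log 2 = Real.log (2 ^ 9) := by rw [Real.log_pow]; norm_num
        rw [this]
        refine Real.log_le_log (by norm_num) ?_
        norm_num
        exact_mod_cast (by omega : 512 ≤ n)
      have h10 := Real.log_two_gt_d9
      have h11 := Real.log_two_lt_d9
      push_cast at h8
      have h12 : (0 : ℝ) ≤ (Nat.log 2 (n / 4) : ℕ) := Nat.cast_nonneg _
      nlinarith
    have h6 : ((n : ℝ) / 4) ^ R / R.factorial ≤ ((n - n / 2).choose R : ℕ) := by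
      refine le_trans ?_ (Nat.pow_le_choose (α := ℝ) R (n - n / 2))
      have h7 : (n : ℝ) ≤ 4 * (n - n / 2 + 1 - R : ℕ) := by
        exact_mod_cast (by omega : n ≤ 4 * (n - n / 2 + 1 - R))
      gcongr
      linarith
    calc min (c₁ / Real.log N) c₂ * ((n : ℝ) ^ (R + 1) * Real.log n)
        ≤ c₂ * ((n : ℝ) ^ (R + 1) * Real.log n) := by
          gcongr
          exact min_le_right _ _
      _ = (n : ℝ) / 16 * (Real.log n / 2 * (((n : ℝ) / 4) ^ R / R.factorial)) := by
          rw [hc₂, div_pow]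
          field_simp
          ring
      _ ≤ _ := by gcongr

end dyadic

/-! ### Geometric progressions in the fibres -/

/-- The number of positive values any two of which differ at least by the factor `1 + 1 / M` is
logarithmic in the ratio of the bounds for them. -/
theorem card_le_one_add_log {α : Type*} (F : Finset α) (y : α → ℤ) {M : ℕ} (hM : 0 < M) {L U : ℝ}
    (hL : 0 < L) (hLU : L ≤ U) (hLy : ∀ a ∈ F, L ≤ y a) (hyU : ∀ a ∈ F, (y a : ℝ) ≤ U)
    (hpair : ∀ a ∈ F, ∀ b ∈ F, a ≠ b →
      (M + 1) * y a ≤ M * y b ∨ (M + 1) * y b ≤ M * y a) :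
    (F.card : ℝ) ≤ 1 + Real.log (U / L) / Real.log (1 + 1 / M) := by
  have hM' : (0 : ℝ) < M := by exact_mod_cast hM
  have hratio : (1 : ℝ) < 1 + 1 / M := by
    have : (0 : ℝ) < 1 / M := by positivity
    linarith
  have hlog : 0 < Real.log (1 + 1 / M) := Real.log_pos hratio
  have hpos : ∀ a ∈ F, 0 < y a := fun a ha => by
    have : (0 : ℝ) < y a := hL.trans_le (hLy a ha)
    exact_mod_cast this
  have hinj : Set.InjOn y F := by
    intro a ha b hb hab
    by_contra hne
    have h1 := hpos a ha
    rcases hpair a ha b hb hne with h | h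
    · rw [← hab] at h; linarith
    · rw [← hab] at h; linarith
  -- in increasing order, each value gains a factor of at least `1 + 1 / M` over the previous one
  have hgrow : ∀ Y : Finset ℤ, (∀ z ∈ Y, L ≤ z) →
      (∀ z ∈ Y, ∀ w ∈ Y, z < w → ((M : ℤ) + 1) * z ≤ M * w) → Y.Nonempty →
      ∃ z ∈ Y, L * (1 + 1 / M) ^ (Y.card - 1) ≤ z := by
    intro Y
    induction Y using Finset.induction_on_max with
    | empty => intro _ _ h; exact absurd h (by simp)
    | insert z s hz ih =>
      intro h1 h2 _
      refine ⟨z, Finset.mem_insert_self _ _, ?_⟩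
      rw [Finset.card_insert_of_notMem fun h => lt_irrefl _ (hz z h), Nat.add_sub_cancel]
      rcases s.eq_empty_or_nonempty with rfl | hs
      · simpa using h1 z (Finset.mem_insert_self _ _)
      · obtain ⟨w, hw, hw'⟩ := ih (fun z hz => h1 z (Finset.mem_insert_of_mem hz))
          (fun z hz w hw => h2 z (Finset.mem_insert_of_mem hz) w (Finset.mem_insert_of_mem hw)) hs
        have h3 := h2 w (Finset.mem_insert_of_mem hw) z (Finset.mem_insert_self _ _) (hz w hw)
        have h4 : ((M : ℝ) + 1) * w ≤ M * z := by exact_mod_cast h3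
        have h5 : (1 + 1 / M : ℝ) * w ≤ z := by
          have : (1 + 1 / M : ℝ) * w = ((M + 1) * w) / M := by field_simp
          rw [this, div_le_iff₀ hM']
          linarith
        have hc : s.card = s.card - 1 + 1 := by have := hs.card_pos; omega
        rw [hc, pow_succ]
        calc L * ((1 + 1 / M) ^ (s.card - 1) * (1 + 1 / M))
            = (1 + 1 / M) * (L * (1 + 1 / M) ^ (s.card - 1)) := by ring
          _ ≤ (1 + 1 / M) * w := by gcongr
          _ ≤ z := h5
  rw [← Finset.card_image_of_injOn hinj]
  rcases F.eq_empty_or_nonempty with rfl | hF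
  · have : 0 ≤ Real.log (U / L) := Real.log_nonneg ((one_le_div hL).2 hLU)
    simp only [Finset.image_empty, Finset.card_empty, Nat.cast_zero]
    positivity
  · obtain ⟨z, hz, hz'⟩ := hgrow (F.image y)
      (fun z hz => by
        obtain ⟨a, ha, rfl⟩ := Finset.mem_image.1 hz
        exact hLy a ha)
      (fun z hz w hw hzw => by
        obtain ⟨a, ha, rfl⟩ := Finset.mem_image.1 hz
        obtain ⟨b, hb, rfl⟩ := Finset.mem_image.1 hw
        have h1 := hpos a ha
        rcases hpair a ha b hb (by rintro rfl; exact lt_irrefl _ hzw) with h | h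
        · exact h
        · have : (M : ℤ) * y a ≤ M * y b := by gcongr
          linarith)
      (hF.image y)
    obtain ⟨a, ha, rfl⟩ := Finset.mem_image.1 hz
    have h1 : (1 + 1 / M : ℝ) ^ ((F.image y).card - 1) ≤ U / L := by
      rw [le_div_iff₀ hL]
      linarith [hyU a ha]
    have h2 := Real.log_le_log (by positivity) h1
    rw [Real.log_pow, Nat.cast_sub (hF.image y).card_pos] at h2
    rw [← sub_le_iff_le_add', le_div_iff₀ hlog]
    exact_mod_cast h2

section fibres

variable {R n M : ℕ} {F : Finset (Fin (R + 2) → ℤ)} {p : Fin (R + 2)}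

theorem gap_le_of_gap_pos {a : Fin (R + 2) → ℤ} (h : ∀ q, 0 < gap n a q) (q) : gap n a q ≤ n := by
  induction q using Fin.lastCases with
  | last =>
    rw [gap_last]
    have := (strictMono_of_gap_pos h).monotone (Fin.zero_le (Fin.last (R + 1)))
    linarith
  | cast i =>
    rw [gap_castSucc]
    have := lt_add_of_gap_pos h i.succ i.castSucc
    linarith

/-- Changing the entry in position `p` changes the two adjacent gaps by opposite amounts. -/
theorem gap_sub_of_agree {a b : Fin (R + 2) → ℤ} (h : ∀ q, q ≠ p → a q = b q) :
    gap n b (p - 1) - gap n a (p - 1) = b p - a p ∧ gap n b p - gap n a p = a p - b p := by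
  have h1 : p - 1 ≠ p := by simp
  have h2 : p + 1 ≠ p := by simp
  simp only [gap, sub_add_cancel, h _ h1, h _ h2]
  constructor <;> ring

/-- If all moves in position `p` inside `F` are large compared to one of the adjacent gaps, then `F`
is small: it splits into the tuples with the smaller gap on the left and those with the smaller gap
on the right, and each part is geometric. -/
theorem card_fibre_le (hM : 0 < M) (hF : ∀ a ∈ F, ∀ b ∈ F, ∀ q, q ≠ p → a q = b q)
    {L U : ℝ} (hL : 0 < L) (hLU : L ≤ U)
    (hl : ∀ a ∈ F, L ≤ gap n a (p - 1) ∧ (gap n a (p - 1) : ℝ) ≤ U)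
    (hr : ∀ a ∈ F, L ≤ gap n a p ∧ (gap n a p : ℝ) ≤ U)
    (hmove : ∀ a ∈ F, ∀ b ∈ F, a p < b p →
      gap n a (p - 1) < M * (b p - a p) ∨ gap n a p < M * (b p - a p)) :
    (F.card : ℝ) ≤ 2 * (1 + Real.log (U / L) / Real.log (1 + 1 / M)) := by
  have hne : ∀ a ∈ F, ∀ b ∈ F, a ≠ b → a p < b p ∨ b p < a p := by
    intro a ha b hb hab
    refine lt_or_gt_of_ne fun h => hab (funext fun q => ?_)
    by_cases hq : q = p
    · rw [hq, h]
    · exact hF a ha b hb q hq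
  have h1 : (({a ∈ F | gap n a (p - 1) ≤ gap n a p} : Finset _).card : ℝ) ≤
      1 + Real.log (U / L) / Real.log (1 + 1 / M) := by
    refine card_le_one_add_log _ (fun a => gap n a (p - 1)) hM hL hLU
      (fun a ha => (hl a (Finset.mem_filter.1 ha).1).1)
      (fun a ha => (hl a (Finset.mem_filter.1 ha).1).2) ?_
    have key : ∀ a ∈ ({a ∈ F | gap n a (p - 1) ≤ gap n a p} : Finset _),
        ∀ b ∈ ({a ∈ F | gap n a (p - 1) ≤ gap n a p} : Finset _), a p < b p →
        ((M : ℤ) + 1) * gap n a (p - 1) ≤ M * gap n b (p - 1) := by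
      intro a ha b hb hab
      rw [Finset.mem_filter] at ha hb
      have h2 := (gap_sub_of_agree (n := n) (hF a ha.1 b hb.1)).1
      have h3 : gap n b (p - 1) = gap n a (p - 1) + (b p - a p) := by linarith
      rw [h3, mul_add]
      rcases hmove a ha.1 b hb.1 hab with h | h <;> linarith [ha.2]
    intro a ha b hb hab
    rcases hne a (Finset.mem_filter.1 ha).1 b (Finset.mem_filter.1 hb).1 hab with h | h
    · exact Or.inl (key a ha b hb h)
    · exact Or.inr (key b hb a ha h)
  have h2 : (({a ∈ F | ¬ gap n a (p - 1) ≤ gap n a p} : Finset _).card : ℝ) ≤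
      1 + Real.log (U / L) / Real.log (1 + 1 / M) := by
    refine card_le_one_add_log _ (fun a => gap n a p) hM hL hLU
      (fun a ha => (hr a (Finset.mem_filter.1 ha).1).1)
      (fun a ha => (hr a (Finset.mem_filter.1 ha).1).2) ?_
    have key : ∀ a ∈ ({a ∈ F | ¬ gap n a (p - 1) ≤ gap n a p} : Finset _),
        ∀ b ∈ ({a ∈ F | ¬ gap n a (p - 1) ≤ gap n a p} : Finset _), a p < b p →
        ((M : ℤ) + 1) * gap n b p ≤ M * gap n a p := by
      intro a ha b hb hab
      rw [Finset.mem_filter] at ha hb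
      have h2 := (gap_sub_of_agree (n := n) (hF a ha.1 b hb.1)).2
      have h3 : gap n a p = gap n b p + (b p - a p) := by linarith
      have h4 : gap n b p ≤ gap n a p := by linarith
      have h5 : gap n a p < M * (b p - a p) := by
        rcases hmove a ha.1 b hb.1 hab with h | h <;> linarith [not_le.1 ha.2]
      have h6 : (M : ℤ) * gap n a p = M * gap n b p + M * (b p - a p) := by
        rw [← mul_add, ← h3]
      linarith
    intro a ha b hb hab
    rcases hne a (Finset.mem_filter.1 ha).1 b (Finset.mem_filter.1 hb).1 hab with h | h
    · exact Or.inr (key a ha b hb h)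
    · exact Or.inl (key b hb a ha h)
  have h3 := Finset.card_filter_add_card_filter_not (s := F)
    (fun a => gap n a (p - 1) ≤ gap n a p)
  have h4 : (F.card : ℝ) = ({a ∈ F | gap n a (p - 1) ≤ gap n a p} : Finset _).card +
      ({a ∈ F | ¬ gap n a (p - 1) ≤ gap n a p} : Finset _).card := by exact_mod_cast h3.symm
  linarith

/-- If moreover one adjacent gap is always the larger one and moves are large compared to it, then
it varies by a factor of at most `2`, and `F` has bounded size. -/
theorem card_fibre_le_of_larger (hM : 0 < M) (hF : ∀ a ∈ F, ∀ b ∈ F, ∀ q, q ≠ p → a q = b q)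
    (hpos : ∀ a ∈ F, ∀ q, 0 < gap n a q) {q q' : Fin (R + 2)}
    (hq : q = p - 1 ∧ q' = p ∨ q = p ∧ q' = p - 1) (hle : ∀ a ∈ F, gap n a q' ≤ gap n a q)
    (hmove : ∀ a ∈ F, ∀ b ∈ F, a p < b p → gap n a q < M * (b p - a p)) :
    (F.card : ℝ) ≤ 2 * (1 + Real.log 2 / Real.log (1 + 1 / M)) := by
  rcases F.eq_empty_or_nonempty with rfl | ⟨c, hc⟩
  · have h1 : 0 ≤ Real.log (1 + 1 / M) := Real.log_nonneg (by
      have : (0 : ℝ) ≤ 1 / M := by positivity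
      linarith)
    have h2 : 0 ≤ Real.log 2 := Real.log_nonneg (by norm_num)
    simp only [Finset.card_empty, Nat.cast_zero]
    positivity
  have hsum : ∀ a ∈ F, gap n a q + gap n a q' = gap n c q + gap n c q' := by
    intro a ha
    obtain ⟨h1, h2⟩ := gap_sub_of_agree (n := n) (hF c hc a ha)
    rcases hq with ⟨rfl, rfl⟩ | ⟨rfl, rfl⟩ <;> linarith
  set S : ℝ := ((gap n c q + gap n c q' : ℤ) : ℝ) with hS
  have hS0 : 0 < S := by
    have := add_pos (hpos c hc q) (hpos c hc q')
    rw [hS]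
    exact_mod_cast this
  have hbound : ∀ a ∈ F, S / 2 ≤ gap n a q ∧ (gap n a q : ℝ) ≤ S := by
    intro a ha
    have h1 : ((gap n a q + gap n a q' : ℤ) : ℝ) = S := by rw [hS, hsum a ha]
    push_cast at h1
    have h2 : (gap n a q' : ℝ) ≤ gap n a q := by exact_mod_cast hle a ha
    have h3 : (0 : ℝ) < gap n a q' := by exact_mod_cast hpos a ha q'
    constructor <;> linarith
  have hmain : (F.card : ℝ) ≤ 1 + Real.log (S / (S / 2)) / Real.log (1 + 1 / M) := by
    refine card_le_one_add_log F (fun a => gap n a q) hM (by positivity) (by linarith)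
      (fun a ha => (hbound a ha).1) (fun a ha => (hbound a ha).2) ?_
    have key : ∀ a ∈ F, ∀ b ∈ F, a p < b p → ((M : ℤ) + 1) * gap n a q ≤ M * gap n b q ∨
        ((M : ℤ) + 1) * gap n b q ≤ M * gap n a q := by
      intro a ha b hb hab
      obtain ⟨h1, h2⟩ := gap_sub_of_agree (n := n) (hF a ha b hb)
      have h3 := hmove a ha b hb hab
      rcases hq with ⟨rfl, -⟩ | ⟨rfl, -⟩
      · left
        have h4 : gap n b (p - 1) = gap n a (p - 1) + (b p - a p) := by linarith
        rw [h4, mul_add]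
        linarith
      · right
        have h4 : (M : ℤ) * gap n a q = M * gap n b q + M * (b q - a q) := by
          rw [← mul_add]; congr 1; linarith
        linarith
    intro a ha b hb hab
    have hne : a p ≠ b p := fun h => hab (funext fun x => by
      by_cases hx : x = p
      · rw [hx, h]
      · exact hF a ha b hb x hx)
    rcases lt_or_gt_of_ne hne with h | h
    · exact key a ha b hb h
    · exact (key b hb a ha h).symm
  have h2 : S / (S / 2) = 2 := by field_simp
  rw [h2] at hmain
  have : (0 : ℝ) ≤ F.card := Nat.cast_nonneg _
  have h1 : 0 ≤ Real.log (1 + 1 / M) := Real.log_nonneg (by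
      have : (0 : ℝ) ≤ 1 / M := by positivity
      linarith)
  have h3 : 0 ≤ Real.log 2 := Real.log_nonneg (by norm_num)
  have h4 : 0 ≤ Real.log 2 / Real.log (1 + 1 / M) := by positivity
  linarith

end fibres

theorem card_le_mul_of_fibres {α β : Type*} [DecidableEq β] (D : Finset α) (f : α → β)
    (I : Finset β) (hf : ∀ a ∈ D, f a ∈ I) {B : ℝ}
    (hB : ∀ b ∈ I, (({a ∈ D | f a = b} : Finset α).card : ℝ) ≤ B) :
    (D.card : ℝ) ≤ I.card * B := by
  rw [Finset.card_eq_sum_card_fiberwise (f := f) (t := I) hf, Nat.cast_sum, ← nsmul_eq_mul]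
  exact Finset.sum_le_card_nsmul _ _ _ hB

theorem prod_Icc_cast_eq_factorial (n : ℕ) : ∏ d ∈ Finset.Icc 1 n, (d : ℝ) = n.factorial := by
  induction n with
  | zero => simp
  | succ n ih =>
    rw [Finset.prod_Icc_succ_top (by omega), ih, Nat.factorial_succ]
    push_cast
    ring

theorem sum_log_div_le (n : ℕ) : ∑ d ∈ Finset.Icc 1 n, Real.log (n / d) ≤ n := by
  rcases Nat.eq_zero_or_pos n with rfl | hn
  · simp
  have hn' : (0 : ℝ) < n := by exact_mod_cast hn
  have h1 : ∏ d ∈ Finset.Icc 1 n, ((n : ℝ) / d) = (n : ℝ) ^ n / n.factorial := by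
    rw [Finset.prod_div_distrib, Finset.prod_const, Nat.card_Icc, Nat.add_sub_cancel,
      prod_Icc_cast_eq_factorial]
  rw [← Real.log_prod (fun d hd => by
    have := (Finset.mem_Icc.1 hd).1
    positivity), h1]
  calc Real.log ((n : ℝ) ^ n / n.factorial) ≤ Real.log (Real.exp n) :=
        Real.log_le_log (by positivity) (Real.pow_div_factorial_le_exp _ hn'.le _)
    _ = n := Real.log_exp _

/-! ### Upper bounds up to constants -/

section rotation

variable {R n : ℕ}

/-- The last but one position. -/
def penult (R : ℕ) : Fin (R + 2) := (Fin.last R).castSucc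

theorem penult_add_one (R : ℕ) : penult R + 1 = Fin.last (R + 1) := by
  simp [penult]

theorem penult_ne_last (R : ℕ) : penult R ≠ Fin.last (R + 1) := (Fin.castSucc_lt_last _).ne

/-- An increasing tuple in `[0, n)` can be rotated so that the gap before the last entry becomes
minimal. -/
theorem exists_rotation {a : Fin (R + 2) → ℤ} (ha : StrictMono a) (h0 : ∀ i, 0 ≤ a i ∧ a i < n) :
    ∃ b : Fin (R + 2) → ℤ, (∀ i, 0 ≤ b i ∧ b i < 3 * n) ∧ (∀ q, 0 < gap n b q) ∧
      (∀ q, gap n b (penult R) ≤ gap n b q) ∧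
      (∀ j, ∃ i, ∃ m : ℤ, b j = a i + n * m) ∧ ∀ i, ∃ j, ∃ m : ℤ, b j = a i + n * m := by
  -- the periodic extension of the tuple
  set c : ℕ → ℤ := fun i => a (Fin.ofNat _ i) + n * (i / (R + 2) : ℕ) with hc
  have hper : ∀ i d, c (i + (R + 2) * d) = c i + n * d := by
    intro i d
    have h1 : Fin.ofNat (R + 2) (i + (R + 2) * d) = Fin.ofNat (R + 2) i := by
      rw [mod_add_two_eq_iff, Nat.add_mul_mod_self_left]
    simp only [hc, h1, Nat.add_mul_div_left _ _ (show 0 < R + 2 by omega)]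
    push_cast
    ring
  have hsmall : ∀ i (hi : i < R + 2), c i = a ⟨i, hi⟩ := by
    intro i hi
    simp only [hc, ofNat_eq_mk hi, Nat.div_eq_of_lt hi]
    simp
  have hlast : c (R + 2) = a 0 + n := by
    have := hper 0 1
    rw [hsmall 0 (by omega)] at this
    simpa using this
  have hdiff : ∀ i, c (i + 1) - c i = c (i % (R + 2) + 1) - c (i % (R + 2)) := by
    intro i
    have h1 := hper (i % (R + 2)) (i / (R + 2))
    have h2 := hper (i % (R + 2) + 1) (i / (R + 2))
    rw [Nat.mod_add_div] at h1
    rw [show i % (R + 2) + 1 + (R + 2) * (i / (R + 2)) =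
      i % (R + 2) + (R + 2) * (i / (R + 2)) + 1 by ring, Nat.mod_add_div] at h2
    rw [h1, h2]
    ring
  have hpos : ∀ i, 0 < c (i + 1) - c i := by
    intro i
    rw [hdiff]
    have h1 := Nat.mod_lt i (show 0 < R + 2 by omega)
    generalize i % (R + 2) = m at h1 ⊢
    rw [hsmall m h1]
    rcases Nat.lt_or_ge (m + 1) (R + 2) with h | h
    · rw [hsmall _ h]
      have := ha (show (⟨m, h1⟩ : Fin (R + 2)) < ⟨m + 1, h⟩ from Fin.mk_lt_mk.2 (by omega))
      linarith
    · obtain rfl : m = R + 1 := by omega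
      rw [hlast]
      have h2 := (h0 0).1
      have h3 := (h0 ⟨R + 1, h1⟩).2
      linarith
  have hmono : StrictMono c := strictMono_nat_of_lt_succ fun i => by linarith [hpos i]
  obtain ⟨q, hq, hmin⟩ := Finset.exists_min_image (Finset.range (R + 2))
    (fun i => c (i + 1) - c i) ⟨0, by simp⟩
  rw [Finset.mem_range] at hq
  have hmin' : ∀ i, c (q + 1) - c q ≤ c (i + 1) - c i := by
    intro i
    rw [hdiff i]
    exact hmin _ (Finset.mem_range.2 (Nat.mod_lt _ (by omega)))
  have hgap : ∀ j : Fin (R + 2), gap n (fun j : Fin (R + 2) => c (q + 2 + j)) j =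
      c (q + 2 + j + 1) - c (q + 2 + j) := by
    intro j
    induction j using Fin.lastCases with
    | last =>
      rw [gap_last]
      have := hper (q + 2) 1
      simp only [Fin.val_last, Fin.val_zero, add_zero]
      rw [show q + 2 + (R + 1) + 1 = q + 2 + (R + 2) * 1 by ring, this]
      simp
    | cast i =>
      rw [gap_castSucc]
      simp only [Fin.val_succ, Fin.val_castSucc]
      rfl
  refine ⟨fun j => c (q + 2 + j), fun j => ⟨?_, ?_⟩, fun j => ?_, fun j => ?_, fun j => ?_,
    fun i => ?_⟩
  · refine le_trans ?_ (hmono.monotone (Nat.zero_le _))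
    rw [hsmall 0 (by omega)]
    exact (h0 _).1
  · have h1 : c (q + 2 + j) ≤ c (0 + (R + 2) * 2) := hmono.monotone (by omega)
    rw [hper, hsmall 0 (by omega)] at h1
    have h2 := (h0 ⟨0, by omega⟩).2
    push_cast at h1
    simp only
    linarith
  · rw [hgap]
    exact hpos _
  · rw [hgap, hgap]
    have h1 := hper q 1
    have h2 := hper (q + 1) 1
    have h3 : ((penult R : Fin (R + 2)) : ℕ) = R := rfl
    rw [h3, show q + 2 + R + 1 = q + 1 + (R + 2) * 1 by ring,
      show q + 2 + R = q + (R + 2) * 1 by ring, h1, h2]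
    linarith [hmin' (q + 2 + j)]
  · exact ⟨_, _, rfl⟩
  · obtain ⟨s, hs, hs'⟩ := exists_add_mod_eq (q + 2) i
    exact ⟨⟨s, hs⟩, ((q + 2 + s) / (R + 2) : ℕ), by simp only [hc, hs']⟩

variable [NeZero n]

open Classical in
/-- The edges of `H`, written as increasing tuples of integers in `[0, 3 n)` within a window of
length `n`, started in such a way that no cyclic gap is smaller than the one before the last
entry. -/
noncomputable def minGapTuples (H : Finset (Finset (Fin n))) : Finset (Fin (R + 2) → ℤ) :=
  {a ∈ Fintype.piFinset fun _ => Finset.Ico (0 : ℤ) (3 * n) |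
    (∀ q, 0 < gap n a q) ∧ (∀ q, gap n a (penult R) ≤ gap n a q) ∧
      Finset.univ.image (fun j => residue n (a j)) ∈ H}

theorem mem_minGapTuples {H : Finset (Finset (Fin n))} {a : Fin (R + 2) → ℤ} :
    a ∈ minGapTuples H ↔ (∀ i, 0 ≤ a i ∧ a i < 3 * n) ∧ (∀ q, 0 < gap n a q) ∧
      (∀ q, gap n a (penult R) ≤ gap n a q) ∧
      Finset.univ.image (fun j => residue n (a j)) ∈ H := by
  simp [minGapTuples]

theorem card_le_card_minGapTuples {H : Finset (Finset (Fin n))}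
    (hH : (H : Set (Finset (Fin n))).Sized (R + 2)) :
    H.card ≤ (minGapTuples (R := R) H).card := by
  classical
  refine Finset.card_le_card_of_surjOn
    (fun a => Finset.univ.image (fun j => residue n (a j))) ?_
  intro e he
  obtain ⟨a, h1, h2, h3, h4⟩ := exists_sorted_tuple e (hH he)
  obtain ⟨b, g1, g2, g3, g4, g5⟩ := exists_rotation h1 h2
  have himg : Finset.univ.image (fun j => residue n (b j)) = e := by
    ext x
    simp only [Finset.mem_image, Finset.mem_univ, true_and]
    constructor
    · rintro ⟨j, rfl⟩
      obtain ⟨i, m, hm⟩ := g4 j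
      obtain ⟨y, hy, hi⟩ := h3 i
      rwa [hm, hi, residue_natCast_add_mul]
    · intro hx
      obtain ⟨i, hi⟩ := h4 x hx
      obtain ⟨j, m, hm⟩ := g5 i
      exact ⟨j, by rw [hm, hi, residue_natCast_add_mul]⟩
  refine ⟨b, ?_, himg⟩
  rw [Finset.mem_coe, mem_minGapTuples, himg]
  exact ⟨g1, g2, g3, he⟩

end rotation

section moves

variable {R n M : ℕ} {Q : Fin (R + 2) → Prop}

/-- A move in round `t` that increases the entry in position `t` modulo `R + 2` by at most an `M`-th
of each adjacent gap, as far as the gap belongs to `Q`. -/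
def LimitedRaise (n M : ℕ) (Q : Fin (R + 2) → Prop) (t : ℕ) (a a' : Fin (R + 2) → ℤ) : Prop :=
  ∃ x, a' = Function.update a (Fin.ofNat _ t) x ∧ a (Fin.ofNat _ t) < x ∧
    ∀ q, Q q → (q = Fin.ofNat _ t ∨ q + 1 = Fin.ofNat _ t) →
      M * (x - a (Fin.ofNat _ t)) ≤ gap n a q

/-- After few limited moves a gap in `Q` has at most doubled, and neither of its ends has advanced by
more than the original gap. -/
theorem sub_lt_gap_of_limitedRaise {K : ℕ} (hM : 2 * K < M) {A : ℕ → Fin (R + 2) → ℤ}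
    (hA : ∀ t < K, LimitedRaise n M Q t (A t) (A (t + 1))) (h0 : ∀ q, 0 < gap n (A 0) q)
    {q : Fin (R + 2)} (hq : Q q) {t : ℕ} (ht : t ≤ K) : A t q - A 0 q < gap n (A 0) q := by
  set g := gap n (A 0) q with hg
  have hg0 : 0 < g := h0 q
  have hM0 : (0 : ℤ) < M := by exact_mod_cast (by omega : 0 < M)
  have key : ∀ t ≤ K, 0 ≤ A t q - A 0 q ∧ (M : ℤ) * (A t q - A 0 q) ≤ 2 * t * g ∧
      (M : ℤ) * (A t (q + 1) - A 0 (q + 1)) ≤ 2 * t * g := by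
    intro t
    induction t with
    | zero => intro _; simp
    | succ t ih =>
      intro ht
      obtain ⟨h1, h2, h3⟩ := ih (by omega)
      obtain ⟨x, hx, hlt, hle⟩ := hA t (by omega)
      have hgap : gap n (A t) q = g + (A t (q + 1) - A 0 (q + 1)) - (A t q - A 0 q) := by
        simp only [hg, gap]; ring
      have hdouble : gap n (A t) q ≤ 2 * g := by
        have ht' : (2 * t : ℤ) ≤ M := by exact_mod_cast (by omega : 2 * t ≤ M)
        have h4 : 2 * t * g ≤ M * g := mul_le_mul_of_nonneg_right ht' hg0.le
        have h5 : (M : ℤ) * (A t (q + 1) - A 0 (q + 1)) ≤ M * g := h3.trans h4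
        have h6 := le_of_mul_le_mul_left h5 hM0
        linarith
      have hne : q + 1 ≠ q := by simp
      have hexp : (2 * (t + 1 : ℕ) : ℤ) * g = 2 * t * g + 2 * g := by push_cast; ring
      rw [hexp]
      by_cases hp : q = Fin.ofNat _ t
      · have h4 := hle q hq (Or.inl hp)
        rw [← hp] at hx hlt h4
        rw [hx, Function.update_self, Function.update_of_ne hne]
        refine ⟨by linarith, ?_, by linarith⟩
        have : (M : ℤ) * (x - A 0 q) = M * (x - A t q) + M * (A t q - A 0 q) := by ring
        linarith
      · by_cases hp' : q + 1 = Fin.ofNat _ t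
        · have h4 := hle q hq (Or.inr hp')
          rw [← hp'] at hx hlt h4
          rw [hx, Function.update_self, Function.update_of_ne hne.symm]
          refine ⟨h1, by linarith, ?_⟩
          have : (M : ℤ) * (x - A 0 (q + 1)) =
            M * (x - A t (q + 1)) + M * (A t (q + 1) - A 0 (q + 1)) := by ring
          linarith
        · rw [hx, Function.update_of_ne hp, Function.update_of_ne hp']
          exact ⟨h1, by linarith, by linarith⟩
  obtain ⟨-, h2, -⟩ := key t ht
  have ht' : (2 * t : ℤ) < M := by exact_mod_cast (by omega : 2 * t < M)
  have h4 : 2 * t * g < M * g := mul_lt_mul_of_pos_right ht' hg0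
  exact lt_of_mul_lt_mul_left (h2.trans_lt h4) hM0.le

/-- Tuples that agree outside a position and are not linked by a limited move are far apart compared
to an adjacent gap. -/
theorem exists_gap_lt_of_not_limitedRaise {t : ℕ} {a b : Fin (R + 2) → ℤ}
    (h : ¬ LimitedRaise n M Q t a b) (hoff : ∀ q, q ≠ Fin.ofNat _ t → a q = b q)
    (hlt : a (Fin.ofNat _ t) < b (Fin.ofNat _ t)) :
    ∃ q, Q q ∧ (q = Fin.ofNat _ t ∨ q = Fin.ofNat _ t - 1) ∧
      gap n a q < M * (b (Fin.ofNat _ t) - a (Fin.ofNat _ t)) := by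
  by_contra hcon
  push Not at hcon
  refine h ⟨b (Fin.ofNat _ t), funext fun q => ?_, hlt, fun q hq hq' => ?_⟩
  · by_cases hq : q = Fin.ofNat _ t
    · subst hq; simp
    · rw [Function.update_of_ne hq, hoff q hq]
  · exact hcon q hq (hq'.imp id eq_sub_of_add_eq)

/-- The tuples with entries in `[0, 3 n)` that vanish in the positions in `Z`. -/
noncomputable def zeroOn (n : ℕ) (Z : Finset (Fin (R + 2))) : Finset (Fin (R + 2) → ℤ) :=
  Fintype.piFinset fun i => if i ∈ Z then {0} else Finset.Ico (0 : ℤ) (3 * n)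

theorem card_zeroOn (n : ℕ) (Z : Finset (Fin (R + 2))) :
    (zeroOn n Z).card = (3 * n) ^ (R + 2 - Z.card) := by
  have h : ∀ i : Fin (R + 2), (if i ∈ Z then {0} else Finset.Ico (0 : ℤ) (3 * n)).card =
      if i ∈ Z then 1 else 3 * n := by
    intro i
    split_ifs
    · simp
    · rw [Int.card_Ico]; omega
  rw [zeroOn, Fintype.card_piFinset]
  simp only [h]
  rw [Finset.prod_ite, Finset.prod_const_one, one_mul, Finset.prod_const]
  congr 1
  have h1 : ({x | x ∉ Z} : Finset (Fin (R + 2))) = Zᶜ := by ext; simp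
  rw [h1, Finset.card_compl, Fintype.card_fin]

theorem mem_zeroOn {a : Fin (R + 2) → ℤ} (Z : Finset (Fin (R + 2)))
    (ha : ∀ i, 0 ≤ a i ∧ a i < 3 * n) : (fun i => if i ∈ Z then 0 else a i) ∈ zeroOn n Z := by
  rw [zeroOn, Fintype.mem_piFinset]
  intro i
  split_ifs
  · simp
  · exact Finset.mem_Ico.2 (ha i)

theorem agree_of_zeroOn_eq {a b : Fin (R + 2) → ℤ} {Z : Finset (Fin (R + 2))}
    (h : (fun i => if i ∈ Z then 0 else a i) = fun i => if i ∈ Z then 0 else b i)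
    {q} (hq : q ∉ Z) : a q = b q := by
  simpa [hq] using congrFun h q

variable [NeZero n] {H : Finset (Finset (Fin n))}

theorem card_le_of_fibre_bound {D : Finset (Fin (R + 2) → ℤ)} (hD : D ⊆ minGapTuples H)
    (Z : Finset (Fin (R + 2))) {B : ℝ}
    (hB : ∀ F ⊆ D, (∀ a ∈ F, ∀ b ∈ F, ∀ q ∉ Z, a q = b q) → (F.card : ℝ) ≤ B) :
    (D.card : ℝ) ≤ (3 * n : ℝ) ^ (R + 2 - Z.card) * B := by
  have h := card_le_mul_of_fibres D (fun a i => if i ∈ Z then 0 else a i) (zeroOn n Z)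
    (fun a ha => mem_zeroOn Z (mem_minGapTuples.1 (hD ha)).1) (B := B) (fun b _ => by
      refine hB _ (Finset.filter_subset _ _) fun a ha c hc q hq => ?_
      exact agree_of_zeroOn_eq
        ((Finset.mem_filter.1 ha).2.trans (Finset.mem_filter.1 hc).2.symm) hq)
  rw [card_zeroOn] at h
  exact_mod_cast h

/-- The loss in a round if the moves are limited by all gaps. -/
theorem card_round_le_log (hM : 0 < M) (t : ℕ) {D : Finset (Fin (R + 2) → ℤ)}
    (hD : D ⊆ minGapTuples H)
    (hmove : ∀ a ∈ D, ∀ b ∈ D, ¬ LimitedRaise n M (fun _ => True) t a b) :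
    (D.card : ℝ) ≤ (3 * n : ℝ) ^ (R + 1) *
      (2 * (1 + Real.log n / Real.log (1 + 1 / M))) := by
  have hn : (1 : ℝ) ≤ n := by exact_mod_cast Nat.pos_of_neZero n
  have h := card_le_of_fibre_bound hD {Fin.ofNat _ t}
    (B := 2 * (1 + Real.log n / Real.log (1 + 1 / M))) (fun F hF hagree => by
      have hgap : ∀ a ∈ F, ∀ q, (1 : ℝ) ≤ gap n a q ∧ (gap n a q : ℝ) ≤ n := fun a ha q => by
        have h1 := (mem_minGapTuples.1 (hD (hF ha))).2.1
        have h2 := h1 q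
        exact ⟨by exact_mod_cast h2, by exact_mod_cast gap_le_of_gap_pos h1 q⟩
      have hagree' : ∀ a ∈ F, ∀ b ∈ F, ∀ q, q ≠ Fin.ofNat _ t → a q = b q :=
        fun a ha b hb q hq => hagree a ha b hb q (by simpa using hq)
      have := card_fibre_le hM hagree' one_pos hn (fun a ha => hgap a ha _)
        (fun a ha => hgap a ha _) (fun a ha b hb hlt => by
          obtain ⟨q, -, h1, h2⟩ := exists_gap_lt_of_not_limitedRaise
            (hmove a (hF ha) b (hF hb)) (hagree' a ha b hb) hlt
          rcases h1 with rfl | rfl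
          · exact Or.inr h2
          · exact Or.inl h2)
      rwa [div_one] at this)
  simpa using h

/-- The loss in a round if the moves are limited by all gaps but the minimal one. A position next to
the minimal gap is far from its other neighbour, and loses a bounded number of entries per fibre. In
any other position, the loss in a fibre is logarithmic in the ratio of `n` and the minimal gap, which
is bounded on average. -/
theorem card_round_le (hM : 0 < M) (t : ℕ) {D : Finset (Fin (R + 2) → ℤ)}
    (hD : D ⊆ minGapTuples H)
    (hmove : ∀ a ∈ D, ∀ b ∈ D, ¬ LimitedRaise n M (fun q => q ≠ penult R) t a b) :
    (D.card : ℝ) ≤ (3 * n : ℝ) ^ (R + 1) * (2 * (1 + 1 / Real.log (1 + 1 / M))) := by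
  have hn : (1 : ℝ) ≤ n := by exact_mod_cast Nat.pos_of_neZero n
  have hM' : (0 : ℝ) < M := by exact_mod_cast hM
  have hlog : 0 < Real.log (1 + 1 / M) := Real.log_pos (by
    have : (0 : ℝ) < 1 / M := by positivity
    linarith)
  have hT : ∀ a ∈ D, _ := fun a ha => mem_minGapTuples.1 (hD ha)
  have hlog2 : (2 * (1 + Real.log 2 / Real.log (1 + 1 / M)) : ℝ) ≤
      2 * (1 + 1 / Real.log (1 + 1 / M)) := by
    have : Real.log 2 ≤ 1 := by linarith [Real.log_two_lt_d9]
    gcongr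
  set p : Fin (R + 2) := Fin.ofNat _ t with hp
  by_cases hpp : p = penult R
  · have h := card_le_of_fibre_bound hD {p}
      (B := 2 * (1 + Real.log 2 / Real.log (1 + 1 / M))) (fun F hF hagree => by
        have hagree' : ∀ a ∈ F, ∀ b ∈ F, ∀ q, q ≠ p → a q = b q :=
          fun a ha b hb q hq => hagree a ha b hb q (by simpa using hq)
        refine card_fibre_le_of_larger (n := n) hM hagree' (fun a ha => (hT a (hF ha)).2.1)
          (Or.inl ⟨rfl, rfl⟩) (fun a ha => ?_) (fun a ha b hb hlt => ?_)
        · rw [hpp]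
          exact (hT a (hF ha)).2.2.1 _
        · obtain ⟨q, hq, h1, h2⟩ := exists_gap_lt_of_not_limitedRaise
            (hmove a (hF ha) b (hF hb)) (hagree' a ha b hb) hlt
          rcases h1 with rfl | rfl
          · exact absurd hpp hq
          · exact h2)
    rw [Finset.card_singleton] at h
    exact h.trans (mul_le_mul_of_nonneg_left hlog2 (by positivity))
  by_cases hpl : p = Fin.last (R + 1)
  · have hpl' : p - 1 = penult R := by rw [hpl, ← penult_add_one, add_sub_cancel_right]
    have h := card_le_of_fibre_bound hD {p}
      (B := 2 * (1 + Real.log 2 / Real.log (1 + 1 / M))) (fun F hF hagree => by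
        have hagree' : ∀ a ∈ F, ∀ b ∈ F, ∀ q, q ≠ p → a q = b q :=
          fun a ha b hb q hq => hagree a ha b hb q (by simpa using hq)
        refine card_fibre_le_of_larger (n := n) hM hagree' (fun a ha => (hT a (hF ha)).2.1)
          (Or.inr ⟨rfl, rfl⟩) (fun a ha => ?_) (fun a ha b hb hlt => ?_)
        · rw [hpl']
          exact (hT a (hF ha)).2.2.1 _
        · obtain ⟨q, hq, h1, h2⟩ := exists_gap_lt_of_not_limitedRaise
            (hmove a (hF ha) b (hF hb)) (hagree' a ha b hb) hlt
          rcases h1 with rfl | rfl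
          · exact h2
          · exact absurd hpl' hq)
    rw [Finset.card_singleton] at h
    exact h.trans (mul_le_mul_of_nonneg_left hlog2 (by positivity))
  have h := card_le_of_fibre_bound hD {p, Fin.last (R + 1)}
    (B := 2 * n * (1 + 1 / Real.log (1 + 1 / M))) (fun F hF hagree => by
      have hfib := Finset.card_eq_sum_card_fiberwise (s := F) (t := Finset.Icc 1 n)
        (f := fun a => (gap n a (penult R)).toNat) (by
          intro a ha
          have h1 := (hT a (hF ha)).2.1
          have h2 := h1 (penult R)
          have h3 := gap_le_of_gap_pos h1 (penult R)
          simp only [Finset.mem_coe, Finset.mem_Icc]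
          omega)
      have hle : ∀ d ∈ Finset.Icc 1 n,
          (({a ∈ F | (gap n a (penult R)).toNat = d} : Finset _).card : ℝ) ≤
            2 * (1 + Real.log (n / d) / Real.log (1 + 1 / M)) := by
        intro d hd
        rw [Finset.mem_Icc] at hd
        have hgapd : ∀ a ∈ ({a ∈ F | (gap n a (penult R)).toNat = d} : Finset _),
            a ∈ F ∧ gap n a (penult R) = d := by
          intro a ha
          rw [Finset.mem_filter] at ha
          exact ⟨ha.1, by omega⟩
        have hbound : ∀ a ∈ ({a ∈ F | (gap n a (penult R)).toNat = d} : Finset _), ∀ q,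
            (d : ℝ) ≤ gap n a q ∧ (gap n a q : ℝ) ≤ n := by
          intro a ha q
          obtain ⟨h1, h2⟩ := hgapd a ha
          have h3 := (hT a (hF h1)).2.2.1 q
          rw [h2] at h3
          exact ⟨by exact_mod_cast h3, by
            exact_mod_cast gap_le_of_gap_pos (hT a (hF h1)).2.1 q⟩
        -- the minimal gap and the entry before it determine the last entry
        have hagree' : ∀ a ∈ ({a ∈ F | (gap n a (penult R)).toNat = d} : Finset _),
            ∀ b ∈ ({a ∈ F | (gap n a (penult R)).toNat = d} : Finset _),
            ∀ q, q ≠ p → a q = b q := by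
          intro a ha b hb q hq
          obtain ⟨h1, h2⟩ := hgapd a ha
          obtain ⟨h3, h4⟩ := hgapd b hb
          by_cases hql : q = Fin.last (R + 1)
          · have h5 : a (penult R) = b (penult R) := hagree a h1 b h3 _ (by
              simp only [Finset.mem_insert, Finset.mem_singleton, not_or]
              exact ⟨fun h => hpp h.symm, penult_ne_last R⟩)
            simp only [gap, penult_add_one, if_neg (penult_ne_last R)] at h2 h4
            rw [hql]
            linarith
          · exact hagree a h1 b h3 q (by simp [hq, hql])
        refine card_fibre_le hM hagree' (by exact_mod_cast hd.1) (by exact_mod_cast hd.2)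
          (fun a ha => hbound a ha _) (fun a ha => hbound a ha _) (fun a ha b hb hlt => ?_)
        obtain ⟨q, -, h1, h2⟩ := exists_gap_lt_of_not_limitedRaise
          (hmove a (hF (hgapd a ha).1) b (hF (hgapd b hb).1)) (hagree' a ha b hb) hlt
        rcases h1 with rfl | rfl
        · exact Or.inr h2
        · exact Or.inl h2
      rw [hfib, Nat.cast_sum]
      refine (Finset.sum_le_sum hle).trans ?_
      have h1 := sum_log_div_le n
      rw [← Finset.mul_sum, Finset.sum_add_distrib, ← Finset.sum_div]
      have h2 : (∑ d ∈ Finset.Icc 1 n, Real.log (n / d)) / Real.log (1 + 1 / M) ≤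
          n / Real.log (1 + 1 / M) := by gcongr
      have h3 : ∑ _d ∈ Finset.Icc 1 n, (1 : ℝ) = n := by simp
      rw [h3]
      have h4 : 2 * (n : ℝ) * (1 + 1 / Real.log (1 + 1 / M)) =
          2 * (n + n / Real.log (1 + 1 / M)) := by ring
      rw [h4]
      linarith)
  rw [Finset.card_pair hpl, Nat.add_sub_cancel] at h
  refine h.trans ?_
  have h1 : (3 * n : ℝ) ^ R * (2 * n * (1 + 1 / Real.log (1 + 1 / M))) =
      (3 * n : ℝ) ^ R * n * (2 * (1 + 1 / Real.log (1 + 1 / M))) := by ring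
  rw [h1, pow_succ]
  gcongr
  linarith

/-- A hypergraph without a crossing path is lost within `k - 1` rounds of limited moves, provided that
these moves never lead a vertex past the original position of the next one. -/
theorem card_le_of_round_bound {k : ℕ} (hk : 1 ≤ k) (hH : (H : Set (Finset (Fin n))).Sized (R + 2))
    (hfree : ¬ CGContains H (crossingPath (R + 2) k)) (Q : Fin (R + 2) → Prop) {B : ℝ}
    (hround : ∀ t, ∀ D ⊆ minGapTuples (R := R) H,
      (∀ a ∈ D, ∀ b ∈ D, ¬ LimitedRaise n (2 * k) Q t a b) → (D.card : ℝ) ≤ B)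
    (hQ : ∀ A : ℕ → Fin (R + 2) → ℤ, (∀ t < k, A t ∈ minGapTuples H) →
      (∀ t, t + 1 < k → LimitedRaise n (2 * k) Q t (A t) (A (t + 1))) →
      ∀ t < k, ∀ q, ¬ Q q → A t q - A 0 q < gap n (A 0) q) :
    (H.card : ℝ) ≤ k * B := by
  have hB : 0 ≤ B := by
    simpa using hround 0 ∅ (Finset.empty_subset _) (by simp)
  by_contra hlt
  apply hfree
  obtain ⟨A, hA, hm⟩ := exists_chain (minGapTuples (R := R) H) (LimitedRaise n (2 * k) Q) (k - 1)
    (fun _ => B) (fun t _ => hround t _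
      (Finset.sdiff_subset.trans (reach_subset _ _ _)) fun a ha b hb => not_move_of_mem_sdiff ha hb)
    (by
      have h1 : (H.card : ℝ) ≤ (minGapTuples (R := R) H).card := by
        exact_mod_cast card_le_card_minGapTuples hH
      rw [Finset.sum_const, Finset.card_range, nsmul_eq_mul, Nat.cast_sub hk]
      push_cast
      linarith)
  refine cgContains_crossingPath_of_chain k hk H A (fun t ht => ?_)
    (fun t ht => (mem_minGapTuples.1 (hA t (by omega))).2.2.2) fun t ht q => ?_
  · obtain ⟨x, h1, h2, -⟩ := hm t (by omega)
    exact ⟨x, h1, h2⟩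
  · by_cases hq : Q q
    · exact sub_lt_gap_of_limitedRaise (K := k - 1) (by omega) hm
        (mem_minGapTuples.1 (hA 0 (by omega))).2.1 hq (by omega)
    · exact hQ A (fun t ht => hA t (by omega)) (fun t ht => hm t (by omega)) t ht q hq

theorem card_le_mul_log {k : ℕ} (hk : 1 ≤ k) (hH : (H : Set (Finset (Fin n))).Sized (R + 2))
    (hfree : ¬ CGContains H (crossingPath (R + 2) k)) :
    (H.card : ℝ) ≤ k * ((3 * n : ℝ) ^ (R + 1) *
      (2 * (1 + Real.log n / Real.log (1 + 1 / (2 * k : ℕ))))) :=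
  card_le_of_round_bound hk hH hfree (fun _ => True)
    (fun t _ hD hmove => card_round_le_log (by omega) t hD hmove)
    (fun _ _ _ _ _ _ hq => absurd trivial hq)

/-- In a path with at most `2 r - 1` edges, the position before the minimal gap moves only once, and
before the last position does. So this gap need not limit the moves. -/
theorem card_le_mul_pow {k : ℕ} (hk : 1 ≤ k) (hk' : k ≤ 2 * (R + 2) - 1)
    (hH : (H : Set (Finset (Fin n))).Sized (R + 2))
    (hfree : ¬ CGContains H (crossingPath (R + 2) k)) :
    (H.card : ℝ) ≤ k * ((3 * n : ℝ) ^ (R + 1) *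
      (2 * (1 + 1 / Real.log (1 + 1 / (2 * k : ℕ))))) := by
  refine card_le_of_round_bound hk hH hfree (fun q => q ≠ penult R)
    (fun t _ hD hmove => card_round_le (by omega) t hD hmove) ?_
  intro A hA hm t ht q hq
  rw [not_not] at hq
  subst hq
  have hstep : ∀ t, t + 1 < k → ∃ x, A (t + 1) = Function.update (A t) (Fin.ofNat _ t) x :=
    fun t ht => (hm t ht).imp fun _ h => h.1
  have hpen : ∀ u, u + 1 < k → penult R = Fin.ofNat _ u → u = R := by
    intro u hu h
    have h1 : R = u % (R + 2) := congrArg Fin.val h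
    rcases Nat.lt_or_ge u (R + 2) with h2 | h2
    · rw [Nat.mod_eq_of_lt h2] at h1; exact h1.symm
    · rw [Nat.mod_eq_sub_mod h2, Nat.mod_eq_of_lt (by omega)] at h1
      omega
  rcases Nat.lt_or_ge R t with h | h
  · have h1 : A t (penult R) = A (R + 1) (penult R) :=
      eq_of_not_moved hstep h ht fun u hu hut he => by
        have := hpen u (by omega) he
        omega
    have h2 : A (R + 1) (Fin.last (R + 1)) = A 0 (Fin.last (R + 1)) :=
      eq_of_not_moved hstep (Nat.zero_le _) (by omega) fun u _ hu he => by
        have h3 : R + 1 = u % (R + 2) := congrArg Fin.val he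
        rw [Nat.mod_eq_of_lt (by omega)] at h3
        omega
    have h3 := (mem_minGapTuples.1 (hA (R + 1) (by omega))).2.1 (penult R)
    simp only [gap, penult_add_one, if_neg (penult_ne_last R)] at h3 ⊢
    linarith
  · have h1 : A t (penult R) = A 0 (penult R) :=
      eq_of_not_moved hstep (Nat.zero_le _) ht fun u _ hu he => by
        have := hpen u (by omega) he
        omega
    have h2 := (mem_minGapTuples.1 (hA 0 (by omega))).2.1 (penult R)
    rw [h1, sub_self]
    exact h2

end moves

theorem exists_cgEx_le_mul_pow {R k : ℕ} (hk : 1 ≤ k) (hk' : k ≤ 2 * (R + 2) - 1) :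
    ∃ C : ℝ, 0 < C ∧ ∀ n : ℕ, 1 ≤ n →
      (cgEx (R + 2) n (crossingPath (R + 2) k) : ℝ) ≤ C * (n : ℝ) ^ (R + 1) := by
  have hk0 : (0 : ℝ) < (2 * k : ℕ) := by exact_mod_cast (by omega : 0 < 2 * k)
  have hlog : 0 < Real.log (1 + 1 / (2 * k : ℕ)) := Real.log_pos (by
    have : (0 : ℝ) < 1 / (2 * k : ℕ) := by positivity
    linarith)
  have hk1 : (0 : ℝ) < k := by exact_mod_cast hk
  refine ⟨k * (3 ^ (R + 1) * (2 * (1 + 1 / Real.log (1 + 1 / (2 * k : ℕ))))), by positivity,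
    fun n hn => ?_⟩
  have : NeZero n := ⟨by omega⟩
  obtain ⟨H, h1, h2, h3⟩ := exists_card_eq_cgEx (r := R + 2) n hk
  rw [← h3]
  refine (card_le_mul_pow hk hk' h1 h2).trans (le_of_eq ?_)
  rw [mul_pow]
  ring

theorem exists_cgEx_le_mul_log {R k : ℕ} (hk : 1 ≤ k) :
    ∃ C : ℝ, 0 < C ∧ ∀ n : ℕ, 3 ≤ n →
      (cgEx (R + 2) n (crossingPath (R + 2) k) : ℝ) ≤ C * ((n : ℝ) ^ (R + 1) * Real.log n) := by
  have hk0 : (0 : ℝ) < (2 * k : ℕ) := by exact_mod_cast (by omega : 0 < 2 * k)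
  have hlog : 0 < Real.log (1 + 1 / (2 * k : ℕ)) := Real.log_pos (by
    have : (0 : ℝ) < 1 / (2 * k : ℕ) := by positivity
    linarith)
  have hk1 : (0 : ℝ) < k := by exact_mod_cast hk
  refine ⟨k * (3 ^ (R + 1) * (2 * (1 + 1 / Real.log (1 + 1 / (2 * k : ℕ))))), by positivity,
    fun n hn => ?_⟩
  have : NeZero n := ⟨by omega⟩
  obtain ⟨H, h1, h2, h3⟩ := exists_card_eq_cgEx (r := R + 2) n hk
  rw [← h3]
  refine (card_le_mul_log hk h1 h2).trans ?_
  have hn1 : 1 ≤ Real.log n := by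
    rw [Real.le_log_iff_exp_le (by exact_mod_cast (by omega : 0 < n))]
    have : (3 : ℝ) ≤ n := by exact_mod_cast hn
    linarith [Real.exp_one_lt_d9]
  have h4 : 1 + Real.log n / Real.log (1 + 1 / (2 * k : ℕ)) ≤
      Real.log n * (1 + 1 / Real.log (1 + 1 / (2 * k : ℕ))) := by
    rw [mul_add, mul_one, mul_one_div]
    linarith
  calc (k : ℝ) * ((3 * n : ℝ) ^ (R + 1) * (2 * (1 + Real.log n /
        Real.log (1 + 1 / (2 * k : ℕ)))))
      ≤ k * ((3 * n : ℝ) ^ (R + 1) * (2 * (Real.log n *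
        (1 + 1 / Real.log (1 + 1 / (2 * k : ℕ)))))) := by gcongr
    _ = _ := by
      rw [mul_pow]
      ring

/-! ### The four ranges of the length -/

theorem mainTheorem2 (r k : ℕ) (hr : 2 ≤ r) (hk : 1 ≤ k) :
    (k = 1 → ∀ n : ℕ, 2 * r + 1 ≤ n → cgEx r n (crossingPath r k) = 0) ∧
    (2 ≤ k → k ≤ 2 * r - 1 → ∃ c C : ℝ, 0 < c ∧ 0 < C ∧ ∀ n : ℕ, 2 * r + 1 ≤ n →
      c * (n : ℝ) ^ (r - 1) ≤ (cgEx r n (crossingPath r k) : ℝ) ∧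
      (cgEx r n (crossingPath r k) : ℝ) ≤ C * (n : ℝ) ^ (r - 1)) ∧
    (k = r + 1 → ∀ n : ℕ, 2 * r + 1 ≤ n →
      (cgEx r n (crossingPath r k) : ℤ) = (n.choose r : ℤ) - ((n - r).choose r : ℤ)) ∧
    (2 * r ≤ k → ∃ c C : ℝ, 0 < c ∧ 0 < C ∧ ∀ n : ℕ, 2 * r + 1 ≤ n →
      c * ((n : ℝ) ^ (r - 1) * Real.log n) ≤ (cgEx r n (crossingPath r k) : ℝ) ∧
      (cgEx r n (crossingPath r k) : ℝ) ≤ C * ((n : ℝ) ^ (r - 1) * Real.log n)) := by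
  obtain ⟨R, rfl⟩ : ∃ R, r = R + 2 := ⟨r - 2, by omega⟩
  rw [show R + 2 - 1 = R + 1 by omega]
  refine ⟨?_, ?_, ?_, ?_⟩
  · rintro rfl n hn
    have : NeZero n := ⟨by omega⟩
    obtain ⟨H, h1, h2, h3⟩ := exists_card_eq_cgEx (r := R + 2) n hk
    rw [← h3, Finset.card_eq_zero]
    by_contra hne
    exact h2 (cgContains_crossingPath_one h1 (Finset.nonempty_iff_ne_empty.2 hne))
  · intro h2 hk'
    obtain ⟨C, hC, hle⟩ := exists_cgEx_le_mul_pow hk hk'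
    exact ⟨_, C, by positivity, hC, fun n hn => ⟨pow_le_cgEx h2 hn, hle n (by omega)⟩⟩
  · rintro rfl n hn
    have : NeZero n := ⟨by omega⟩
    obtain ⟨H, h1, h2, h3⟩ := exists_card_eq_cgEx (r := R + 2) n hk
    have h4 := card_add_choose_le_of_not_contains (by omega) h1 h2
    have h5 : (lastOrConsecutive (R + 2) n).card ≤
        cgEx (R + 2) n (crossingPath (R + 2) (R + 2 + 1)) :=
      card_le_cgEx hk (fun e he => (Finset.mem_powersetCard.1 (Finset.mem_filter.1 he).1).2)
        lastOrConsecutive_free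
    have h6 := choose_le_card_lastOrConsecutive (r := R + 2) (n := n)
    omega
  · intro hk'
    obtain ⟨c, hc, hge⟩ := exists_mul_log_le_cgEx hk'
    obtain ⟨C, hC, hle⟩ := exists_cgEx_le_mul_log (R := R) hk
    exact ⟨c, C, hc, hC, fun n hn => ⟨hge n hn, hle n (by omega)⟩⟩
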